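/- Let $p$ be a prime, ${\bf k}$ an algebraically closed field of characteristic $p$, $K={\bf k}(u,v)$ the rational function field in two variables and $R={\bf k}[u,v]_{(u,v)}$. Put $$P_0=u,\quad P_1=v,\quad P_2=v^{p^2}-u,\quad P_{i+1}=P_i^{p^2}-u^{p^{2i-2}}P_{i-1}\ (i\ge 2).$$ There is exactly one valuation $\nu$ of $K$ with values in $\mathbb R$ (written additively, $\nu(0)=\infty$) that is trivial on ${\bf k}$ and satisfies $\nu(u)=1$ and $\nu(P_{i+1})>\nu(P_i^{p^2})$ for all $i\ge1$; it is the valuation determined by the sequence $(P_i)$. For a local ring $A\subset K$ with maximal ideal $\mathfrak m$ in which $\nu$ is centered, the quadratic transform of $A$ along $\nu$ is the localization of $A[\mathfrak m/x]$ at the center of $\nu$, where $0\neq x\in \mathfrak m$ has the least value among the elements of $\mathfrak m$. Let $R=R_0\to R_1\to R_2\to\cdots$ be the rings in the sequence of successive quadratic transforms of $R$ along $\nu$ (starting with $R$ itself) in which the divisor of $u$ has a single irreducible component, that is, in which $u$ is a unit times a positive power of an irreducible element, listed in order. Define recursively $P_{0,i}=P_i$ for $i\ge 0$ and, for $k\ge1$,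 $$u_k=P_{k,0}=P_{k-1,1},\qquad P_{k,i}=\frac{P_{k-1,i+1}}{u_k^{p^{2i}}}\ (i\ge1),\qquad\text{in particular } v_k=P_{k,1}=\frac{P_{k-1,2}}{u_k^{p^2}}.$$ Then there are infinitely many rings $R_k$, and for every $k\ge0$ the ring $R_k$ is local, $\nu$ is centered in $R_k$ (nonnegative on $R_k$ and positive exactly on its maximal ideal), and $u_k=P_{k,0},\ v_k=P_{k,1},\ P_{k,2},\dots$ is a generating sequence of $\nu$ in $R_k$: all $P_{k,i}$ lie in $R_k$, and for every $\gamma\in\nu(R_k\setminus\{0\})$ the set $\{f\in R_k\mid \nu(f)\ge\gamma\}$ is the ideal of $R_k$ generated by the finite products $\prod_i P_{k,i}^{a_i}$, $a_i\in\mathbb N_0$, with $\sum_i a_i\nu(P_{k,i})\ge\gamma$. Moreover $$\nu(P_{k,0})=\frac1{p^{2k}},\qquad \nu(P_{k,1})=\frac1{p^{2k+2}},\qquad \nu(P_{k,i})=\sum_{j=0}^{i-1}p^{4j-2i-2k}\quad\text{for } i\ge 1.$$ -/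

import Mathlib

namespace QuadTransform

/-- The localization `k[u,v]_{(u,v)}` as a subring of a field `K = k(u,v)`: all fractions `f / g`
of polynomials with `g(0,0) ≠ 0`. The variables `u`, `v` are `X 0`, `X 1`. -/
def originLocalRing (k K : Type*) [Field k] [Field K] [Algebra (MvPolynomial (Fin 2) k) K] :
    Subring K where
  carrier := {z | ∃ f g : MvPolynomial (Fin 2) k, MvPolynomial.constantCoeff g ≠ 0 ∧
    algebraMap (MvPolynomial (Fin 2) k) K g ≠ 0 ∧
    z = algebraMap (MvPolynomial (Fin 2) k) K f / algebraMap (MvPolynomial (Fin 2) k) K g}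
  mul_mem' := by
    rintro _ _ ⟨f, g, hg, hg', rfl⟩ ⟨f₁, g₁, hg₁, hg₁', rfl⟩
    refine ⟨f * f₁, g * g₁, by simp [hg, hg₁], by simp [hg', hg₁'], ?_⟩
    simp [div_mul_div_comm]
  one_mem' := ⟨1, 1, by simp, by simp, by simp⟩
  add_mem' := by
    rintro _ _ ⟨f, g, hg, hg', rfl⟩ ⟨f₁, g₁, hg₁, hg₁', rfl⟩
    refine ⟨f * g₁ + g * f₁, g * g₁, by simp [hg, hg₁], by simp [hg', hg₁'], ?_⟩
    simp [div_add_div _ _ hg' hg₁']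
  zero_mem' := ⟨0, 1, by simp, by simp, by simp⟩
  neg_mem' := by
    rintro _ ⟨f, g, hg, hg', rfl⟩
    exact ⟨-f, g, hg, hg', by simp [neg_div]⟩

section Field

variable {K : Type*} [Field K]

/-- The fractions `a / b` with `a, b ∈ B` and `ν b = 0`. When `ν` is nonnegative on `B` this is
the localization of `B` at the center `{b ∈ B | 0 < ν b}` of `ν`. -/
def localizeAtCenter (ν : AddValuation K (WithTop ℝ)) (B : Subring K) : Subring K where
  carrier := {z | ∃ a ∈ B, ∃ b ∈ B, ν b = 0 ∧ z = a / b}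
  mul_mem' := by
    rintro _ _ ⟨a, ha, b, hb, h, rfl⟩ ⟨a₁, ha₁, b₁, hb₁, h₁, rfl⟩
    exact ⟨a * a₁, B.mul_mem ha ha₁, b * b₁, B.mul_mem hb hb₁, by simp [h, h₁],
      by rw [div_mul_div_comm]⟩
  one_mem' := ⟨1, B.one_mem, 1, B.one_mem, by simp, by simp⟩
  add_mem' := by
    rintro _ _ ⟨a, ha, b, hb, h, rfl⟩ ⟨a₁, ha₁, b₁, hb₁, h₁, rfl⟩
    have hb0 : b ≠ 0 := by rintro rfl; simp at h
    have hb0' : b₁ ≠ 0 := by rintro rfl; simp at h₁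
    exact ⟨a * b₁ + b * a₁, B.add_mem (B.mul_mem ha hb₁) (B.mul_mem hb ha₁), b * b₁,
      B.mul_mem hb hb₁, by simp [h, h₁], by rw [div_add_div _ _ hb0 hb0']⟩
  zero_mem' := ⟨0, B.zero_mem, 1, B.one_mem, by simp, by simp⟩
  neg_mem' := by
    rintro _ ⟨a, ha, b, hb, h, rfl⟩
    exact ⟨-a, B.neg_mem ha, b, hb, h, by rw [neg_div]⟩

/-- The nonunits of a subring `A` of `K`, as elements of `K`; for a local ring `A` this is its
maximal ideal. -/
def nonunitSet (A : Subring K) : Set K := (fun a : A => (a : K)) '' nonunits A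

/-- The quadratic transform of a local ring `A` (with maximal ideal `m`) along `ν`: adjoin to `A`
the quotients `y / x` with `x, y ∈ m`, where `x ≠ 0` has the least value among the elements
of `m`, and localize at the center of `ν`. (Different choices of `x` of least value give the same
local ring `A[m/x]_{center}`, so it does not matter that all of them are used.) -/
def quadraticTransform (ν : AddValuation K (WithTop ℝ)) (A : Subring K) : Subring K :=
  localizeAtCenter ν (Subring.closure ((A : Set K) ∪
    {z | ∃ x ∈ nonunitSet A, ∃ y ∈ nonunitSet A,
      x ≠ 0 ∧ (∀ w ∈ nonunitSet A, ν x ≤ ν w) ∧ z = y / x}))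

/-- The divisor of `f` on `Spec A` (`A` a factorial local ring) has a single irreducible component:
`f` lies in `A` and is a unit times a positive power of an irreducible element of `A`. -/
def HasSingleComponent (A : Subring K) (f : K) : Prop :=
  ∃ hf : f ∈ A, ∃ t : A, Irreducible t ∧ ∃ n : ℕ, 0 < n ∧ Associated (t ^ n) (⟨f, hf⟩ : A)

/-- All successive quadratic transforms of `R` along `ν`. -/
def transformSeq (ν : AddValuation K (WithTop ℝ)) (R : Subring K) (n : ℕ) : Subring K :=
  (quadraticTransform ν)^[n] R

/-- The indices of the transforms of `R` along `ν` that are free, that is, in which the divisor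
of `u` has a single irreducible component. -/
def freeIndices (ν : AddValuation K (WithTop ℝ)) (R : Subring K) (u : K) : Set ℕ :=
  {n | HasSingleComponent (transformSeq ν R n) u}

/-- `R_k`: the `k`-th (counting from `0`) free ring in the sequence of quadratic transforms
of `R` along `ν`. -/
noncomputable def freeTransform (ν : AddValuation K (WithTop ℝ)) (R : Subring K) (u : K) (k : ℕ) :
    Subring K :=
  transformSeq ν R (Nat.nth (fun n => n ∈ freeIndices ν R u) k)

/-- `A` is a local ring and `ν` is centered in it: `ν` is nonnegative on `A` and positive exactly
on the maximal ideal of `A`. -/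
def IsCenteredIn (ν : AddValuation K (WithTop ℝ)) (A : Subring K) : Prop :=
  IsLocalRing A ∧ ∀ a : A, 0 ≤ ν (a : K) ∧ (0 < ν (a : K) ↔ a ∈ nonunits A)

/-- `P` is a generating sequence of `ν` in `A`: a sequence of elements of `A` such that, for every
value `γ` of a nonzero element of `A`, the set `I_γ = {f ∈ A | ν f ≥ γ}` is the ideal of `A`
generated by the (finite) products `∏ P_i ^ a_i` with `∑ a_i ν(P_i) ≥ γ`. -/
def IsGeneratingSequence (ν : AddValuation K (WithTop ℝ)) (A : Subring K) (P : ℕ → K) : Prop :=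
  ∃ hP : ∀ i, P i ∈ A, ∀ γ : WithTop ℝ, (∃ f : A, f ≠ 0 ∧ ν (f : K) = γ) →
    {f : A | γ ≤ ν (f : K)} =
      (Ideal.span {z : A | ∃ a : ℕ →₀ ℕ, γ ≤ a.sum (fun i n => n • ν (P i)) ∧
        z = a.prod (fun i n => (⟨P i, hP i⟩ : A) ^ n)} : Set A)

/-- `P_0 = u`, `P_1 = v`, `P_2 = v^{p^2} - u`, and
`P_{i+1} = P_i^{p^2} - u^{p^{2i-2}} P_{i-1}` for `i ≥ 2`. -/
def P (p : ℕ) (u v : K) : ℕ → K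
  | 0 => u
  | 1 => v
  | 2 => v ^ p ^ 2 - u
  | (i + 3) => P p u v (i + 2) ^ p ^ 2 - u ^ p ^ (2 * (i + 1)) * P p u v (i + 1)

/-- `P_{0,i} = P_i`, and for `k ≥ 1`, with `u_k = P_{k,0} = P_{k-1,1}`,
`P_{k,i} = P_{k-1,i+1} / u_k^{p^{2i}}` for `i ≥ 1`. In particular
`v_k = P_{k,1} = P_{k-1,2} / u_k^{p^2}`. -/
def PP (p : ℕ) (u v : K) : ℕ → ℕ → K
  | 0, i => P p u v i
  | (k + 1), 0 => PP p u v k 1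
  | (k + 1), (i + 1) => PP p u v k (i + 2) / PP p u v k 1 ^ p ^ (2 * (i + 1))

end Field

/-- The conditions that single out the valuation of `K = k(u,v)` determined by the sequence `P_i`:
it is trivial on `k`, it is normalized by `ν(u) = 1`, and each `P_{i+1}`, `i ≥ 1`, has a larger
value than the term `P_i^{p^2}` in its definition. -/
structure IsDeterminedByP (k : Type*) {K : Type*} [Field k] [Field K]
    [Algebra (MvPolynomial (Fin 2) k) K] (p : ℕ) (ν : AddValuation K (WithTop ℝ)) : Prop where
  trivial_on : ∀ a : k, a ≠ 0 → ν (algebraMap (MvPolynomial (Fin 2) k) K (MvPolynomial.C a)) = 0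
  normalized : ν (algebraMap (MvPolynomial (Fin 2) k) K (MvPolynomial.X 0)) = 1
  jump : ∀ i : ℕ, 1 ≤ i →
    ν (P p (algebraMap (MvPolynomial (Fin 2) k) K (MvPolynomial.X 0))
        (algebraMap (MvPolynomial (Fin 2) k) K (MvPolynomial.X 1)) i ^ p ^ 2) <
    ν (P p (algebraMap (MvPolynomial (Fin 2) k) K (MvPolynomial.X 0))
        (algebraMap (MvPolynomial (Fin 2) k) K (MvPolynomial.X 1)) (i + 1))

end QuadTransform

/-!
Write `q = p ^ 2`, and call a sequence satisfying the recursion of the `P_i` up to factors on the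
subtracted terms, with values proportional to `β_0 = 1`, `β_1 = 1 / q`, `q β_{i+1} = q ^ i + β_i`
for `i ≥ 1`, a key sequence.

*Generation and uniqueness.* By the recursion, `P_i ^ q` is a multiple of a monomial of the same
value in earlier elements plus `P_{i+1}`, which has larger value. So modulo the ideal of the
monomials of value at least `γ`, every element is a combination, with coefficients in the field
`k`, of monomials of value less than `γ` whose exponents of positive index are smaller than `q`
(`IsKeySequence.reduces_mul_mono`). Since `β_i` has denominator exactly `q ^ i`, these have
pairwise distinct values (`IsStd.eq_of_wt_eq`), and an element of value at least `γ` lies in the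
ideal (`IsKeySequence.mem_monoIdeal`). This only uses that the ring is `k + (P_0, P_1)` and that
the valuation is trivial on `k` and nonnegative. Applied to `k[u, v]`, where the jump condition forces the values
`β_i`, it also determines the valuation (`IsDeterminedByP.unique`).

*Existence.* The valuation is the order in `t` after substituting `u = t`, `v = ∑ C_{i-1} t ^ (q⁻¹
+ q⁻³ + ⋯ + q^{-(2i-1)})`, `i ≥ 1`, with the Catalan numbers `C_i`, in the field of generalized
power series. In characteristic `p` the `q`-th power is additive, and the coefficients of `P_j(t,
v)` are ballot numbers, whose recursion makes the leading terms cancel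
(`le_orderTop_keyPoly_sub`). The substitution is injective, because an element of its kernel would
lie in all powers of the ideal of the origin (`eq_zero_of_valuation_eq_top`).

*The quadratic transforms.* If the maximal ideal is `(s, t)` with `ν t ≤ ν s`, then that of the
quadratic transform is `(t, w)` for any `w = α + ρ (s / t)` of positive value with `ρ` a unit
(`IsStage.quadraticTransform`). From a free ring with parameters `(u_k, v_k)`, where `ν u_k = q ν
v_k`, the next transforms have parameters `(u_k / v_k ^ j, v_k)`, `j < q`, and the `q`-th one has
`(v_k, P_{k,2} / v_k ^ q) = (u_{k+1}, v_{k+1})`. Dividing the recursion by the powers of `v_k`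
gives the same recursion for the `P_{k+1,i}` up to units (`IsFreeStage.next`).

*Free rings.* The maximal ideal is never principal, since the differences `β_{i+1} - q β_i = q ^
{-(i+1)}`, `i ≥ 1`, are arbitrarily small; hence both parameters are irreducible
(`IsStage.irreducible_left`), and `u`, a unit times `u_k ^ (q ^ k)`, has a single component in the
`q k`-th ring. All rings are localizations of polynomial rings in two variables, so factorial
(`IsCoordinateRing.prime_of_irreducible`), and for `0 < j < q` both parameters are primes dividing
`u`, which therefore has two components. So the free rings are those whose index is a multiple of
`q`.
-/

namespace QuadTransform

/-! ### The values of the generating sequence -/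

/-- The numerators of the normalized values: `1, 1, 1 + q ^ 2, 1 + q ^ 2 + q ^ 4, …`. -/
def keyNumer (q : ℕ) : ℕ → ℕ
  | 0 => 1
  | 1 => 1
  | (i + 2) => q ^ (2 * (i + 1)) + keyNumer q (i + 1)

/-- The value of `P_i` when `ν u = 1`, where `q = p ^ 2`. -/
noncomputable def keyValue (q : ℕ) (i : ℕ) : ℝ := keyNumer q i / (q : ℝ) ^ i

lemma keyNumer_eq (q i : ℕ) : keyNumer q (i + 1) = ∑ j ∈ Finset.range (i + 1), q ^ (2 * j) := by
  induction i with
  | zero => simp [keyNumer]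
  | succ i ih => rw [Finset.sum_range_succ, ← ih, keyNumer, add_comm]

lemma keyNumer_modEq_one (q i : ℕ) : ∃ m, keyNumer q i = 1 + q * m := by
  match i with
  | 0 => exact ⟨0, rfl⟩
  | 1 => exact ⟨0, rfl⟩
  | i + 2 =>
    obtain ⟨m, hm⟩ := keyNumer_modEq_one q (i + 1)
    exact ⟨q ^ (2 * i + 1) + m, by rw [keyNumer, hm]; ring⟩

lemma keyNumer_pos (q i : ℕ) : 0 < keyNumer q i := by
  obtain ⟨m, hm⟩ := keyNumer_modEq_one q i
  omega

@[simp] lemma keyValue_zero (q : ℕ) : keyValue q 0 = 1 := by simp [keyValue, keyNumer]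

lemma keyValue_one (q : ℕ) : keyValue q 1 = 1 / q := by simp [keyValue, keyNumer]

lemma mul_keyValue_one {q : ℕ} (hq : 2 ≤ q) : q * keyValue q 1 = 1 := by
  have : (q : ℝ) ≠ 0 := by positivity
  rw [keyValue_one]; field_simp

lemma mul_keyValue {q : ℕ} (hq : 2 ≤ q) (i : ℕ) :
    q * keyValue q (i + 2) = (q : ℝ) ^ (i + 1) + keyValue q (i + 1) := by
  have : (q : ℝ) ≠ 0 := by positivity
  simp only [keyValue, keyNumer]
  push_cast
  field_simp
  ring

lemma keyValue_succ_sub {q : ℕ} (hq : 2 ≤ q) (i : ℕ) :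
    keyValue q (i + 2) - q * keyValue q (i + 1) = 1 / (q : ℝ) ^ (i + 2) := by
  have h0 : (q : ℝ) ≠ 0 := by positivity
  induction i with
  | zero =>
    have h := mul_keyValue hq 0
    rw [zero_add, zero_add, keyValue_one] at *
    field_simp at h ⊢
    linarith
  | succ i ih =>
    have h1 := mul_keyValue hq i
    have h2 := mul_keyValue hq (i + 1)
    have : (q : ℝ) * (keyValue q (i + 1 + 2) - q * keyValue q (i + 1 + 1))
        = q * (1 / (q : ℝ) ^ (i + 1 + 2)) := by
      rw [mul_sub, h2, show i + 1 + 1 = i + 2 from rfl, h1]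
      have : (q : ℝ) * (1 / (q : ℝ) ^ (i + 1 + 2)) = 1 / (q : ℝ) ^ (i + 2) := by
        field_simp
        ring
      rw [this, ← ih]; ring
    exact mul_left_cancel₀ h0 this

lemma keyValue_jump {q : ℕ} (hq : 2 ≤ q) (i : ℕ) :
    q * keyValue q (i + 1) < keyValue q (i + 2) := by
  have := keyValue_succ_sub hq i
  have h : 0 < 1 / (q : ℝ) ^ (i + 2) := by positivity
  linarith

lemma keyValue_pos {q : ℕ} (hq : 2 ≤ q) (i : ℕ) : 0 < keyValue q i := by
  have := keyNumer_pos q i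
  unfold keyValue; positivity

lemma pow_le_keyValue {q : ℕ} (hq : 2 ≤ q) (i : ℕ) : (q : ℝ) ^ i ≤ keyValue q (i + 2) := by
  have h0 : (0 : ℝ) < q := by positivity
  have h1 := mul_keyValue hq i
  have h2 := keyValue_pos hq (i + 1)
  refine le_of_mul_le_mul_left ?_ h0
  rw [h1, pow_succ]; linarith

lemma keyValue_le {q : ℕ} (hq : 2 ≤ q) (i : ℕ) : keyValue q (i + 2) ≤ 2 * (q : ℝ) ^ i := by
  have h0 : (0 : ℝ) < q := by positivity
  have hq' : (2 : ℝ) ≤ q := by exact_mod_cast hq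
  refine le_of_mul_le_mul_left ?_ h0
  rw [mul_keyValue hq i]
  match i with
  | 0 =>
    have : keyValue q 1 ≤ 1 := by
      rw [keyValue_one]
      exact div_le_one_of_le₀ (by linarith) h0.le
    simp only [zero_add]; linarith [pow_one (q : ℝ), pow_zero (q : ℝ)]
  | i + 1 =>
    have := keyValue_le hq i
    have h3 : (q : ℝ) ^ (i + 1) = q ^ i * q := pow_succ _ _
    have h4 : (q : ℝ) ^ (i + 1 + 1) = q ^ i * q * q := by ring
    have h5 : (0 : ℝ) < q ^ i := by positivity
    rw [h3, h4]
    have h6 : 2 * (q : ℝ) ^ i ≤ q ^ i * q * q := by nlinarith [mul_pos h5 h0]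
    show (q : ℝ) ^ i * q * q + keyValue q (i + 2) ≤ _
    linarith

/-- Division with remainder by `q` at the largest index shows that a vanishing combination of
the values whose coefficients of positive index are smaller than `q` is trivial. -/
lemma eq_zero_of_sum_keyValue_eq_zero {q : ℕ} (hq : 2 ≤ q) (n : ℕ) (d : ℕ → ℤ)
    (hd : ∀ i, 1 ≤ i → |d i| < q)
    (h : ∑ i ∈ Finset.range (n + 1), (d i : ℝ) * keyValue q i = 0) : ∀ i ≤ n, d i = 0 := by
  have h0 : (q : ℝ) ≠ 0 := by positivity
  induction n with
  | zero =>
    intro i hi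
    obtain rfl : i = 0 := by omega
    simpa using h
  | succ n ih =>
    have hz : (∑ i ∈ Finset.range (n + 1), d i * keyNumer q i * (q : ℤ) ^ (n - i)) * q +
        d (n + 1) * keyNumer q (n + 1) = 0 := by
      have : (((∑ i ∈ Finset.range (n + 1), d i * keyNumer q i * (q : ℤ) ^ (n - i)) * q +
        d (n + 1) * keyNumer q (n + 1) : ℤ) : ℝ) =
          (∑ i ∈ Finset.range (n + 1 + 1), (d i : ℝ) * keyValue q i) * (q : ℝ) ^ (n + 1) := by
        rw [Finset.sum_range_succ _ (n + 1), add_mul, Finset.sum_mul]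
        push_cast
        rw [Finset.sum_mul]
        congr 1
        · refine Finset.sum_congr rfl fun i hi => ?_
          have hi' : i ≤ n := by simpa [Nat.lt_succ_iff] using hi
          obtain ⟨m, rfl⟩ := Nat.exists_eq_add_of_le hi'
          simp only [keyValue, Nat.add_sub_cancel_left]
          field_simp
          ring
        · simp only [keyValue]
          field_simp
      rw [h, zero_mul] at this
      exact_mod_cast this
    have hdn : d (n + 1) = 0 := by
      obtain ⟨m, hm⟩ := keyNumer_modEq_one q (n + 1)
      refine Int.eq_zero_of_abs_lt_dvd (m := q) ?_ (hd _ (by omega))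
      rw [hm] at hz
      refine ⟨-(∑ i ∈ Finset.range (n + 1), d i * keyNumer q i * (q : ℤ) ^ (n - i)) -
        d (n + 1) * m, ?_⟩
      push_cast at hz
      linarith
    rw [Finset.sum_range_succ, hdn] at h
    simp only [Int.cast_zero, zero_mul, add_zero] at h
    intro i hi
    rcases Nat.lt_or_ge n i with h' | h'
    · obtain rfl : i = n + 1 := by omega
      exact hdn
    · exact ih h i h'

/-! ### Monomials in a key sequence -/

section Monomial

variable {R : Type*} [CommRing R]

/-- The monomial `∏ P_i ^ a_i`. -/
noncomputable def mono (P : ℕ → R) (a : ℕ →₀ ℕ) : R := a.prod fun i n => P i ^ n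

lemma mono_add (P : ℕ → R) (a b : ℕ →₀ ℕ) : mono P (a + b) = mono P a * mono P b :=
  Finsupp.prod_add_index' (by simp) (by intros; rw [pow_add])

@[simp] lemma mono_single (P : ℕ → R) (i n : ℕ) : mono P (Finsupp.single i n) = P i ^ n :=
  Finsupp.prod_single_index (by simp)

@[simp] lemma mono_zero (P : ℕ → R) : mono P 0 = 1 := Finsupp.prod_zero_index

/-- The value `∑ a_i b_i` of a monomial whose `i`-th variable has value `b_i`. -/
noncomputable def wt (b : ℕ → ℝ) (a : ℕ →₀ ℕ) : ℝ := a.sum fun i n => (n : ℝ) * b i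

lemma wt_add (b : ℕ → ℝ) (a a' : ℕ →₀ ℕ) : wt b (a + a') = wt b a + wt b a' :=
  Finsupp.sum_add_index' (by simp) (by intros; push_cast; ring)

@[simp] lemma wt_single (b : ℕ → ℝ) (i n : ℕ) : wt b (Finsupp.single i n) = n * b i :=
  Finsupp.sum_single_index (by simp)

@[simp] lemma wt_zero (b : ℕ → ℝ) : wt b 0 = 0 := Finsupp.sum_zero_index

lemma valuation_mono (ν : AddValuation R (WithTop ℝ)) {P : ℕ → R} {b : ℕ → ℝ}
    (h : ∀ i, ν (P i) = (b i : WithTop ℝ)) (a : ℕ →₀ ℕ) : ν (mono P a) = (wt b a : WithTop ℝ) := by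
  induction a using Finsupp.induction_linear with
  | zero => simp
  | add f g hf hg => rw [mono_add, wt_add, ν.map_mul, hf, hg]; rfl
  | single i n => rw [mono_single, wt_single, ν.map_pow, h, ← WithTop.coe_nsmul, nsmul_eq_mul]

/-- The ideal generated by the monomials of value at least `γ`. -/
noncomputable def monoIdeal (P : ℕ → R) (b : ℕ → ℝ) (γ : ℝ) : Ideal R :=
  Ideal.span {z | ∃ a : ℕ →₀ ℕ, γ ≤ wt b a ∧ z = mono P a}

lemma mono_mem_monoIdeal (P : ℕ → R) {b : ℕ → ℝ} {γ : ℝ} {a : ℕ →₀ ℕ} (h : γ ≤ wt b a) :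
    mono P a ∈ monoIdeal P b γ := Ideal.subset_span ⟨a, h, rfl⟩

/-- If `ν` is nonnegative, elements of the ideal generated by monomials of value at least `γ`
have value at least `γ`. -/
lemma le_valuation_of_mem_monoIdeal (ν : AddValuation R (WithTop ℝ)) (hν : ∀ r, 0 ≤ ν r)
    {P : ℕ → R} {b : ℕ → ℝ} (h : ∀ i, ν (P i) = (b i : WithTop ℝ)) {γ : ℝ} {f : R}
    (hf : f ∈ monoIdeal P b γ) : (γ : WithTop ℝ) ≤ ν f := by
  refine Submodule.span_induction ?_ ?_ ?_ ?_ hf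
  · rintro _ ⟨a, ha, rfl⟩
    rw [valuation_mono ν h]
    exact_mod_cast ha
  · simp
  · intro x y _ _ hx hy
    exact ν.map_le_add hx hy
  · intro r x _ hx
    rw [smul_eq_mul, ν.map_mul]
    simpa using add_le_add (hν r) hx

lemma finite_wt_lt {b : ℕ → ℝ} (hb : ∀ i, 0 < b i) (hb' : ∀ γ, ∃ I, ∀ i, I ≤ i → γ ≤ b i) (γ : ℝ) :
    {a : ℕ →₀ ℕ | wt b a < γ}.Finite := by
  obtain ⟨I, hI⟩ := hb' γ
  let g : ℕ →₀ ℕ := Finsupp.onFinset (Finset.range I)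
    (fun i => if i < I then ⌈γ / b i⌉₊ else 0) (by intro i; simp; tauto)
  refine (Set.finite_Iic g).subset fun a ha => ?_
  have hle : ∀ i, (a i : ℝ) * b i < γ := by
    intro i
    refine lt_of_le_of_lt ?_ ha
    by_cases hi : i ∈ a.support
    · exact Finset.single_le_sum (f := fun i => (a i : ℝ) * b i)
        (fun j _ => mul_nonneg (Nat.cast_nonneg _) (hb j).le) hi
    · rw [Finsupp.notMem_support_iff.mp hi, Nat.cast_zero, zero_mul]
      exact Finset.sum_nonneg fun j _ => mul_nonneg (Nat.cast_nonneg _) (hb j).le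
  intro i
  show a i ≤ if i < I then ⌈γ / b i⌉₊ else 0
  split_ifs with h
  · have : (a i : ℝ) ≤ ⌈γ / b i⌉₊ :=
      ((lt_div_iff₀ (hb i)).mpr (hle i)).le.trans (Nat.le_ceil _)
    exact_mod_cast this
  · have h1 := hI i (by omega)
    have h2 := hle i
    by_contra h3
    have h4 : (1 : ℝ) ≤ a i := by exact_mod_cast (by omega : 1 ≤ a i)
    nlinarith [hb i]

end Monomial

/-! ### Key sequences generate the valuation -/

/-- The algebraic input of the generating sequence property: `ν` is nonnegative on `R`, trivial on
the image of the field `k`, every element of `R` is a constant modulo `(P_0, P_1)`, the values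
of the `P_i` are `l` times the normalized ones, and the `P_i` satisfy the recursion
`P_2 = P_1 ^ q - τ_1 P_0`, `P_{i+1} = P_i ^ q - τ_i P_0 ^ q ^ (i-1) P_{i-1}` for `i ≥ 2`, with
arbitrary factors `τ_i`. The valuation may take the value `⊤` at nonzero elements. -/
structure IsKeySequence {k R : Type*} [Field k] [CommRing R] (κ : k →+* R)
    (ν : AddValuation R (WithTop ℝ)) (q : ℕ) (l : ℝ) (P : ℕ → R) : Prop where
  two_le : 2 ≤ q
  pos : 0 < l
  const : ∀ c, c ≠ 0 → ν (κ c) = 0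
  nonneg : ∀ r, 0 ≤ ν r
  decomp : ∀ r, ∃ c x y, r = κ c + x * P 0 + y * P 1
  val : ∀ i, ν (P i) = ((l * keyValue q i : ℝ) : WithTop ℝ)
  rel_one : ∃ τ, P 1 ^ q = τ * P 0 + P 2
  rel : ∀ i, ∃ τ, P (i + 2) ^ q = τ * (P 0 ^ q ^ (i + 1) * P (i + 1)) + P (i + 3)

/-- A monomial is standard if all its exponents of positive index are smaller than `q`. -/
def IsStd (q : ℕ) (a : ℕ →₀ ℕ) : Prop := ∀ i, a (i + 1) < q

lemma IsStd.eq_of_wt_eq {q : ℕ} (hq : 2 ≤ q) {l : ℝ} (hl : 0 < l) {a a' : ℕ →₀ ℕ}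
    (ha : IsStd q a) (ha' : IsStd q a')
    (h : wt (fun i => l * keyValue q i) a = wt (fun i => l * keyValue q i) a') : a = a' := by
  obtain ⟨n, hn⟩ : ∃ n, a.support ∪ a'.support ⊆ Finset.range (n + 1) :=
    ⟨_, fun i hi => Finset.mem_range.mpr (Nat.lt_succ_of_le (Finset.le_sup (f := id) hi))⟩
  have e : ∀ c : ℕ →₀ ℕ, c.support ⊆ Finset.range (n + 1) → wt (fun i => l * keyValue q i) c =
      l * ∑ i ∈ Finset.range (n + 1), (c i : ℝ) * keyValue q i := by
    intro c hc
    rw [wt, Finsupp.sum_of_support_subset _ hc _ (by simp), Finset.mul_sum]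
    exact Finset.sum_congr rfl fun i _ => by ring
  rw [e a (Finset.union_subset_left hn), e a' (Finset.union_subset_right hn)] at h
  have h' := mul_left_cancel₀ hl.ne' h
  have key := eq_zero_of_sum_keyValue_eq_zero hq n (fun i => (a i : ℤ) - a' i)
    (by
      intro i hi
      obtain ⟨j, rfl⟩ := Nat.exists_eq_add_of_le' hi
      have h1 := ha j
      have h2 := ha' j
      rw [abs_lt]; constructor <;> omega)
    (by
      push_cast
      simp only [sub_mul, Finset.sum_sub_distrib]
      rw [h', sub_self])
  ext i
  by_cases hi : i ≤ n
  · have := key i hi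
    omega
  · have h1 : i ∉ a.support := fun h =>
      hi (by simpa [Nat.lt_succ_iff] using hn (Finset.mem_union_left _ h))
    have h2 : i ∉ a'.support := fun h =>
      hi (by simpa [Nat.lt_succ_iff] using hn (Finset.mem_union_right _ h))
    rw [Finsupp.notMem_support_iff.mp h1, Finsupp.notMem_support_iff.mp h2]

namespace IsKeySequence

variable {k R : Type*} [Field k] [CommRing R] {κ : k →+* R}
    {ν : AddValuation R (WithTop ℝ)} {q : ℕ} {l : ℝ} {P : ℕ → R}

lemma finite (h : IsKeySequence κ ν q l P) (γ : ℝ) :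
    {a : ℕ →₀ ℕ | wt (fun i => l * keyValue q i) a < γ}.Finite := by
  refine finite_wt_lt (fun i => mul_pos h.pos (keyValue_pos h.two_le i)) (fun γ => ?_) γ
  obtain ⟨n, hn⟩ := exists_nat_ge (γ / l)
  refine ⟨n + 2, fun i hi => ?_⟩
  obtain ⟨j, rfl⟩ : ∃ j, i = j + 2 := ⟨i - 2, by omega⟩
  have h1 : (j : ℝ) ≤ (q : ℝ) ^ j := by
    exact_mod_cast (Nat.lt_pow_self h.two_le).le
  have h2 : (n : ℝ) ≤ j := by exact_mod_cast (by omega : n ≤ j)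
  have h3 := pow_le_keyValue h.two_le j
  have h4 : γ / l ≤ keyValue q (j + 2) := by linarith
  rwa [div_le_iff₀' h.pos] at h4

/-- `f` is, modulo the ideal of the monomials of value at least `γ`, a combination of standard
monomials of value less than `γ` with coefficients in `k`. -/
def Reduces (κ : k →+* R) (q : ℕ) (b : ℕ → ℝ) (P : ℕ → R) (γ : ℝ) (f : R) : Prop :=
  ∃ c : (ℕ →₀ ℕ) →₀ k, (∀ a ∈ c.support, IsStd q a ∧ wt b a < γ) ∧
    f - c.sum (fun a x => κ x * mono P a) ∈ monoIdeal P b γ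

lemma Reduces.add {b : ℕ → ℝ} {γ : ℝ} {f g : R} (hf : Reduces κ q b P γ f)
    (hg : Reduces κ q b P γ g) : Reduces κ q b P γ (f + g) := by
  obtain ⟨c, hc, hc'⟩ := hf
  obtain ⟨d, hd, hd'⟩ := hg
  classical
  refine ⟨c + d, fun a ha => ?_, ?_⟩
  · rcases Finset.mem_union.mp (Finsupp.support_add ha) with h | h
    exacts [hc a h, hd a h]
  · rw [Finsupp.sum_add_index' (by simp) (by intros; rw [map_add, add_mul])]
    convert add_mem hc' hd' using 1
    ring

lemma Reduces.of_mem {b : ℕ → ℝ} {γ : ℝ} {f : R} (hf : f ∈ monoIdeal P b γ) :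
    Reduces κ q b P γ f := ⟨0, by simp, by simpa using hf⟩

/-- Every multiple of a monomial reduces. A constant multiple of a nonstandard monomial is
rewritten by the recursion, which either raises the value or keeps it and lowers `∑ i * a_i`;
there are only finitely many monomials of value less than `γ`. -/
lemma reduces_mul_mono (h : IsKeySequence κ ν q l P) (γ : ℝ) (a : ℕ →₀ ℕ) (r : R) :
    Reduces κ q (fun i => l * keyValue q i) P γ (r * mono P a) := by
  set b : ℕ → ℝ := fun i => l * keyValue q i with hb
  have hq := h.two_le
  have hb0 : ∀ i, 0 < b i := fun i => mul_pos h.pos (keyValue_pos hq i)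
  obtain ⟨N, hN⟩ : ∃ N, {a' | wt b a < wt b a' ∧ wt b a' < γ}.ncard = N := ⟨_, rfl⟩
  obtain ⟨W, hW⟩ : ∃ W, (a.sum fun i n => n * i) = W := ⟨_, rfl⟩
  induction N using Nat.strong_induction_on generalizing a r W with
  | _ N ihN =>
  induction W using Nat.strong_induction_on generalizing a r with
  | _ W ihW =>
  rcases le_or_gt γ (wt b a) with hγ | hγ
  · exact Reduces.of_mem (Ideal.mul_mem_left _ _ (mono_mem_monoIdeal P hγ))
  -- monomials of larger value are covered by the outer induction
  have up : ∀ a'' r', wt b a < wt b a'' → Reduces κ q b P γ (r' * mono P a'') := by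
    intro a'' r' hlt
    rcases le_or_gt γ (wt b a'') with hγ' | hγ'
    · exact Reduces.of_mem (Ideal.mul_mem_left _ _ (mono_mem_monoIdeal P hγ'))
    refine ihN _ ?_ a'' r' rfl _ rfl
    rw [← hN]
    refine Set.ncard_lt_ncard ⟨fun x hx => ⟨hlt.trans hx.1, hx.2⟩, fun hss => ?_⟩
      ((h.finite γ).subset fun x hx => hx.2)
    exact lt_irrefl _ (hss ⟨hlt, hγ'⟩ : a'' ∈ {a' | wt b a'' < wt b a' ∧ wt b a' < γ}).1
  obtain ⟨c, x, y, rfl⟩ := h.decomp r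
  have e : (κ c + x * P 0 + y * P 1) * mono P a = κ c * mono P a +
      x * mono P (a + Finsupp.single 0 1) + y * mono P (a + Finsupp.single 1 1) := by
    simp only [mono_add, mono_single]; ring
  rw [e]
  refine Reduces.add (Reduces.add ?_ (up _ _ ?_)) (up _ _ ?_)
  rotate_left
  · rw [wt_add, wt_single]; simpa using hb0 0
  · rw [wt_add, wt_single]; simpa using hb0 1
  by_cases hstd : IsStd q a
  · classical
    refine ⟨Finsupp.single a c, fun a' ha' => ?_, ?_⟩
    · rw [Finset.mem_singleton.mp (Finsupp.support_single_subset ha')]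
      exact ⟨hstd, hγ⟩
    · rw [Finsupp.sum_single_index (by simp), sub_self]
      exact zero_mem _
  simp only [IsStd, not_forall, not_lt] at hstd
  obtain ⟨j, hj⟩ := hstd
  obtain ⟨a0, rfl⟩ : ∃ a0, a = a0 + Finsupp.single (j + 1) q :=
    ⟨a - Finsupp.single (j + 1) q, (tsub_add_cancel_of_le (by simpa using hj)).symm⟩
  have hsum : ∀ a a' : ℕ →₀ ℕ, ((a + a').sum fun i n => n * i) =
      (a.sum fun i n => n * i) + a'.sum fun i n => n * i := fun a a' =>
    Finsupp.sum_add_index' (by simp) (by intros; ring)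
  -- the recursion, and its effect on values and on `∑ i * a_i`
  obtain ⟨τ, low, hrel, hval, hlow⟩ : ∃ (τ : R) (low : ℕ →₀ ℕ),
      P (j + 1) ^ q = τ * mono P low + P (j + 2) ∧ wt b low = q * b (j + 1) ∧
      (low.sum fun i n => n * i) < q * (j + 1) := by
    match j with
    | 0 =>
      obtain ⟨τ, hτ⟩ := h.rel_one
      refine ⟨τ, Finsupp.single 0 1, by simpa using hτ, ?_, ?_⟩
      · rw [wt_single]
        have := mul_keyValue_one hq
        simp only [hb, keyValue_zero]
        push_cast; linear_combination (-l) * this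
      · rw [Finsupp.sum_single_index (by simp)]; omega
    | j + 1 =>
      obtain ⟨τ, hτ⟩ := h.rel j
      refine ⟨τ, Finsupp.single 0 (q ^ (j + 1)) + Finsupp.single (j + 1) 1, ?_, ?_, ?_⟩
      · rw [mono_add, mono_single, mono_single, pow_one]; exact hτ
      · rw [wt_add, wt_single, wt_single]
        have := mul_keyValue hq j
        simp only [hb, keyValue_zero]
        push_cast; linear_combination (-l) * this
      · rw [hsum, Finsupp.sum_single_index (by simp), Finsupp.sum_single_index (by simp)]
        nlinarith
  have e2 : κ c * mono P (a0 + Finsupp.single (j + 1) q) = (κ c * τ) * mono P (a0 + low) +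
      κ c * mono P (a0 + Finsupp.single (j + 2) 1) := by
    simp only [mono_add, mono_single]
    rw [hrel]; ring
  have hwt : wt b (a0 + low) = wt b (a0 + Finsupp.single (j + 1) q) := by
    rw [wt_add, wt_add, wt_single, hval]
  rw [e2]
  refine Reduces.add ?_ (up _ _ ?_)
  · refine ihW _ ?_ (a0 + low) (κ c * τ) (by rw [hwt]; exact hN) rfl
    rw [← hW, hsum, hsum, Finsupp.sum_single_index (by simp)]
    omega
  · rw [wt_add, wt_add, wt_single, wt_single]
    have := mul_lt_mul_of_pos_left (keyValue_jump hq j) h.pos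
    simp only [hb]; push_cast; linarith

/-- The elements of value at least `γ` lie in the ideal generated by the monomials of value
at least `γ`: distinct standard monomials have distinct values, so no standard monomial
of value less than `γ` survives in the reduction. -/
theorem mem_monoIdeal (h : IsKeySequence κ ν q l P) {γ : ℝ} {f : R} (hf : (γ : WithTop ℝ) ≤ ν f) :
    f ∈ monoIdeal P (fun i => l * keyValue q i) γ := by
  set b : ℕ → ℝ := fun i => l * keyValue q i with hb
  obtain ⟨c, hc, hmem⟩ : Reduces κ q b P γ f := by
    simpa using h.reduces_mul_mono γ 0 f
  rcases eq_or_ne c 0 with rfl | hc0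
  · simpa using hmem
  exfalso
  obtain ⟨a, ha, hmin⟩ := Finset.exists_min_image c.support (wt b)
    (Finsupp.support_nonempty_iff.mpr hc0)
  have hval : ∀ a ∈ c.support, ν (κ (c a) * mono P a) = (wt b a : WithTop ℝ) := by
    intro a ha
    rw [ν.map_mul, h.const _ (Finsupp.mem_support_iff.mp ha), zero_add, valuation_mono ν h.val]
  have hrest : (wt b a : WithTop ℝ) < ν (∑ x ∈ c.support.erase a, κ (c x) * mono P x) := by
    refine ν.map_lt_sum (WithTop.coe_ne_top) fun x hx => ?_
    have hx' := Finset.mem_of_mem_erase hx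
    rw [hval x hx']
    refine WithTop.coe_lt_coe.mpr (lt_of_le_of_ne (hmin x hx') fun heq => ?_)
    exact Finset.ne_of_mem_erase hx ((hc x hx').1.eq_of_wt_eq h.two_le h.pos (hc a ha).1 heq.symm)
  have hγ : (wt b a : WithTop ℝ) < γ := WithTop.coe_lt_coe.mpr (hc a ha).2
  have hres := le_valuation_of_mem_monoIdeal ν h.nonneg h.val hmem
  have hsplit : f = κ (c a) * mono P a + ((∑ x ∈ c.support.erase a, κ (c x) * mono P x) +
      (f - c.sum (fun a x => κ x * mono P a))) := by
    rw [Finsupp.sum, ← Finset.add_sum_erase _ _ ha]; ring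
  have : ν f = (wt b a : WithTop ℝ) := by
    rw [hsplit, ν.map_add_eq_of_lt_left, hval a ha]
    rw [hval a ha]
    exact ν.map_lt_add hrest (hγ.trans_le hres)
  rw [this] at hf
  exact absurd hf (not_le.mpr hγ)

end IsKeySequence

/-! ### The sequence `P_i` over a commutative ring, and its values -/

/-- The recursion defining `P_i`, over an arbitrary commutative ring. -/
def keyPoly {R : Type*} [CommRing R] (q : ℕ) (u v : R) : ℕ → R
  | 0 => u
  | 1 => v
  | 2 => v ^ q - u
  | (i + 3) => keyPoly q u v (i + 2) ^ q - u ^ q ^ (i + 1) * keyPoly q u v (i + 1)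

lemma map_keyPoly {R S : Type*} [CommRing R] [CommRing S] (f : R →+* S) (q : ℕ) (u v : R) :
    ∀ i, f (keyPoly q u v i) = keyPoly q (f u) (f v) i
  | 0 => rfl
  | 1 => rfl
  | 2 => by simp [keyPoly]
  | (i + 3) => by
    simp only [keyPoly, map_sub, map_mul, map_pow, map_keyPoly f q u v (i + 2),
      map_keyPoly f q u v (i + 1)]

lemma P_eq_keyPoly {K : Type*} [Field K] (p : ℕ) (u v : K) :
    ∀ i, P p u v i = keyPoly (p ^ 2) u v i
  | 0 => rfl
  | 1 => rfl
  | 2 => rfl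
  | (i + 3) => by
    simp only [keyPoly, P, P_eq_keyPoly p u v (i + 2), P_eq_keyPoly p u v (i + 1), ← pow_mul]

lemma eq_coe_of_nsmul_eq_coe {q : ℕ} (hq : 0 < q) {x : WithTop ℝ} {y : ℝ}
    (h : q • x = ((q * y : ℝ) : WithTop ℝ)) : x = (y : WithTop ℝ) := by
  induction x using WithTop.recTopCoe with
  | top =>
    obtain ⟨n, rfl⟩ : ∃ n, q = n + 1 := ⟨q - 1, by omega⟩
    rw [succ_nsmul, add_top] at h
    exact absurd h.symm WithTop.coe_ne_top
  | coe x =>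
    rw [← WithTop.coe_nsmul, nsmul_eq_mul] at h
    have h' := WithTop.coe_injective h
    have : (q : ℝ) ≠ 0 := by positivity
    rw [mul_left_cancel₀ this h']

/-- If `ν u = 1` and `ν P_{i+1} > ν (P_i ^ q)`, then `P_i ^ q` has the value of the other
term of the recursion, which determines all values. -/
theorem valuation_keyPoly {R : Type*} [CommRing R] {q : ℕ} (hq : 2 ≤ q)
    (ν : AddValuation R (WithTop ℝ)) {u v : R} (hu : ν u = 1)
    (hj : ∀ i, ν (keyPoly q u v (i + 1) ^ q) < ν (keyPoly q u v (i + 2))) :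
    ∀ i, ν (keyPoly q u v i) = (keyValue q i : WithTop ℝ)
  | 0 => by simpa [keyPoly] using hu
  | 1 => by
    have h := hj 0
    have h2 : ν (v ^ q) = ν u := by
      have := ν.map_eq_of_lt_sub (x := v ^ q) (y := u)
      rw [ν.map_sub_swap] at this
      exact (this h).symm
    rw [ν.map_pow, hu] at h2
    refine eq_coe_of_nsmul_eq_coe (q := q) (by omega) ?_
    rw [mul_keyValue_one hq]
    exact h2
  | (i + 2) => by
    have h := hj (i + 1)
    have h2 := ν.map_eq_of_lt_sub (x := keyPoly q u v (i + 2) ^ q)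
      (y := u ^ q ^ (i + 1) * keyPoly q u v (i + 1))
    rw [ν.map_sub_swap] at h2
    have h3 := (h2 h).symm
    rw [ν.map_pow, ν.map_mul, ν.map_pow, hu, valuation_keyPoly hq ν hu hj (i + 1)] at h3
    refine eq_coe_of_nsmul_eq_coe (q := q) (by omega) ?_
    rw [mul_keyValue hq, h3, ← WithTop.coe_one, ← WithTop.coe_nsmul, ← WithTop.coe_add]
    simp

section Polynomial

open MvPolynomial

variable {k : Type*} [Field k]

lemma exists_eq_C_add (f : MvPolynomial (Fin 2) k) :
    ∃ g h, f = C (constantCoeff f) + g * X 0 + h * X 1 := by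
  induction f using MvPolynomial.induction_on with
  | C a => exact ⟨0, 0, by simp⟩
  | add f f' hf hf' =>
    obtain ⟨g, h, e⟩ := hf
    obtain ⟨g', h', e'⟩ := hf'
    refine ⟨g + g', h + h', ?_⟩
    rw [map_add, map_add]
    linear_combination e + e'
  | mul_X f i hf =>
    rcases Fin.exists_fin_two.mp ⟨i, rfl⟩ with h | h
    · exact ⟨f, 0, by rw [← h]; simp⟩
    · exact ⟨0, f, by rw [← h]; simp⟩

lemma nonneg_polynomial (ν : AddValuation (MvPolynomial (Fin 2) k) (WithTop ℝ))
    (hC : ∀ c, c ≠ 0 → ν (C c) = 0) (hX : ∀ i, 0 ≤ ν (X i)) (f) : 0 ≤ ν f := by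
  induction f using MvPolynomial.induction_on with
  | C a =>
    rcases eq_or_ne a 0 with rfl | h
    · simp
    · exact (hC a h).ge
  | add f f' hf hf' => exact ν.map_le_add hf hf'
  | mul_X f i hf =>
    rw [ν.map_mul]
    exact add_nonneg hf (hX i)

/-- The `P_i` form a key sequence of every (semi)valuation on the polynomial ring satisfying the
defining conditions. -/
lemma isKeySequence_polynomial {q : ℕ} (hq : 2 ≤ q)
    (ν : AddValuation (MvPolynomial (Fin 2) k) (WithTop ℝ)) (hC : ∀ c, c ≠ 0 → ν (C c) = 0)
    (hval : ∀ i, ν (keyPoly q (X 0) (X 1) i) = (keyValue q i : WithTop ℝ)) :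
    IsKeySequence C ν q 1 (keyPoly q (X 0) (X 1)) where
  two_le := hq
  pos := one_pos
  const := hC
  nonneg := by
    refine nonneg_polynomial ν hC fun i => ?_
    have h0 := hval 0
    have h1 := hval 1
    have n0 : (0 : WithTop ℝ) ≤ keyValue q 0 := by exact_mod_cast (keyValue_pos hq 0).le
    have n1 : (0 : WithTop ℝ) ≤ keyValue q 1 := by exact_mod_cast (keyValue_pos hq 1).le
    rcases Fin.exists_fin_two.mp ⟨i, rfl⟩ with h | h
    · rw [h]; exact n0.trans h0.ge
    · rw [h]; exact n1.trans h1.ge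
  decomp := fun r => by
    obtain ⟨g, h, e⟩ := exists_eq_C_add r
    exact ⟨_, g, h, e⟩
  val := by simpa using hval
  rel_one := ⟨1, by simp [keyPoly]⟩
  rel := fun i => ⟨1, by simp [keyPoly]⟩

variable {K : Type*} [Field K] [Algebra (MvPolynomial (Fin 2) k) K]

lemma IsDeterminedByP.valuation_keyPoly {p : ℕ} (hp : p.Prime) {ν : AddValuation K (WithTop ℝ)}
    (h : IsDeterminedByP k p ν) (i : ℕ) :
    ν (algebraMap (MvPolynomial (Fin 2) k) K (keyPoly (p ^ 2) (X 0) (X 1) i)) =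
      (keyValue (p ^ 2) i : WithTop ℝ) := by
  rw [map_keyPoly]
  refine QuadTransform.valuation_keyPoly ?_ ν h.normalized (fun i => ?_) i
  · nlinarith [hp.two_le]
  · have := h.jump (i + 1) (by omega)
    rwa [P_eq_keyPoly, P_eq_keyPoly] at this

lemma IsDeterminedByP.isKeySequence {p : ℕ} (hp : p.Prime) {ν : AddValuation K (WithTop ℝ)}
    (h : IsDeterminedByP k p ν) :
    IsKeySequence C (ν.comap (algebraMap (MvPolynomial (Fin 2) k) K)) (p ^ 2) 1
      (keyPoly (p ^ 2) (X 0) (X 1)) :=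
  isKeySequence_polynomial (by nlinarith [hp.two_le]) _ h.trivial_on (h.valuation_keyPoly hp)

lemma IsDeterminedByP.le {p : ℕ} (hp : p.Prime) {ν ν' : AddValuation K (WithTop ℝ)}
    (h : IsDeterminedByP k p ν) (h' : IsDeterminedByP k p ν') (f : MvPolynomial (Fin 2) k) :
    ν (algebraMap _ K f) ≤ ν' (algebraMap _ K f) := by
  have hs := h.isKeySequence hp
  have hs' := h'.isKeySequence hp
  refine WithTop.forall_coe_le_iff_le.mp fun γ hγ => ?_
  exact le_valuation_of_mem_monoIdeal _ hs'.nonneg hs'.val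
    (hs.mem_monoIdeal (f := f) hγ)

/-- The value of a polynomial is the largest `γ` such that it lies in the ideal of
the monomials of value at least `γ`, which does not depend on the valuation. -/
theorem IsDeterminedByP.unique [IsFractionRing (MvPolynomial (Fin 2) k) K] {p : ℕ} (hp : p.Prime)
    {ν ν' : AddValuation K (WithTop ℝ)} (h : IsDeterminedByP k p ν)
    (h' : IsDeterminedByP k p ν') : ν = ν' := by
  refine AddValuation.ext fun z => ?_
  obtain ⟨f, g, -, rfl⟩ := IsFractionRing.div_surjective (A := MvPolynomial (Fin 2) k) z
  rw [ν.map_div, ν'.map_div, le_antisymm (h.le hp h' f) (h'.le hp h f),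
    le_antisymm (h.le hp h' g) (h'.le hp h g)]

/-! ### Monomials of large value have large order at the origin -/

/-- The ideal of the origin. -/
noncomputable def originIdeal (k : Type*) [Field k] : Ideal (MvPolynomial (Fin 2) k) :=
  Ideal.span {X 0, X 1}

lemma X_mem_originIdeal (i : Fin 2) : (X i : MvPolynomial (Fin 2) k) ∈ originIdeal k := by
  refine Ideal.subset_span ?_
  rcases Fin.exists_fin_two.mp ⟨i, rfl⟩ with h | h <;> simp [← h]

lemma originIdeal_ne_top : originIdeal k ≠ ⊤ := by
  intro h
  have : (1 : MvPolynomial (Fin 2) k) ∈ RingHom.ker (constantCoeff (R := k) (σ := Fin 2)) := by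
    have hle : originIdeal k ≤ RingHom.ker (constantCoeff (R := k) (σ := Fin 2)) := by
      rw [originIdeal, Ideal.span_le]
      rintro _ (rfl | rfl) <;> simp [RingHom.mem_ker]
    exact hle (h ▸ Submodule.mem_top)
  simp [RingHom.mem_ker] at this

lemma keyPoly_mem_pow {q : ℕ} (hq : 2 ≤ q) :
    ∀ i, keyPoly q (X 0) (X 1) (i + 2) ∈ originIdeal k ^ q ^ i
  | 0 => by
    simp only [pow_zero, pow_one, keyPoly]
    exact sub_mem (Ideal.pow_mem_of_mem _ (X_mem_originIdeal 1) _ (by omega))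
      (X_mem_originIdeal 0)
  | (i + 1) => by
    have h1 := keyPoly_mem_pow hq i
    rw [show i + 1 + 2 = i + 3 from rfl, keyPoly]
    refine sub_mem ?_ (Ideal.mul_mem_right _ _ (Ideal.pow_mem_pow (X_mem_originIdeal 0) _))
    rw [pow_succ, pow_mul]
    exact Ideal.pow_mem_pow h1 q

lemma exists_mono_mem_pow {q : ℕ} (hq : 2 ≤ q) (a : ℕ →₀ ℕ) :
    ∃ n : ℕ, mono (keyPoly q (X 0) (X 1)) a ∈ originIdeal k ^ n ∧
      wt (keyValue q) a ≤ 2 * n := by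
  induction a using Finsupp.induction_linear with
  | zero => exact ⟨0, by simp, by simp⟩
  | add f g hf hg =>
    obtain ⟨n, hn, hn'⟩ := hf
    obtain ⟨m, hm, hm'⟩ := hg
    refine ⟨n + m, ?_, ?_⟩
    · rw [mono_add, pow_add]; exact Ideal.mul_mem_mul hn hm
    · rw [wt_add]; push_cast; linarith
  | single i n =>
    obtain ⟨m, hm, hm'⟩ : ∃ m : ℕ, keyPoly q (X 0) (X 1) i ∈ originIdeal k ^ m ∧
        keyValue q i ≤ 2 * m := by
      match i with
      | 0 => exact ⟨1, by simpa [keyPoly] using X_mem_originIdeal 0, by norm_num⟩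
      | 1 =>
        refine ⟨1, by simpa [keyPoly] using X_mem_originIdeal 1, ?_⟩
        have := mul_keyValue_one hq
        have h2 := keyValue_pos hq 1
        have h3 : (2 : ℝ) ≤ q := by exact_mod_cast hq
        push_cast
        nlinarith
      | i + 2 => exact ⟨q ^ i, keyPoly_mem_pow hq i, by push_cast; exact keyValue_le hq i⟩
    refine ⟨m * n, ?_, ?_⟩
    · rw [mono_single, pow_mul]; exact Ideal.pow_mem_pow hm n
    · rw [wt_single]; push_cast
      nlinarith [(Nat.cast_nonneg n : (0 : ℝ) ≤ n)]

/-- An element of infinite value lies in all powers of the ideal of the origin. -/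
lemma eq_zero_of_valuation_eq_top {q : ℕ} {ν : AddValuation (MvPolynomial (Fin 2) k) (WithTop ℝ)}
    (h : IsKeySequence C ν q 1 (keyPoly q (X 0) (X 1))) {f : MvPolynomial (Fin 2) k}
    (hf : ν f = ⊤) : f = 0 := by
  have hmem : f ∈ ⨅ n, originIdeal k ^ n := by
    rw [Submodule.mem_iInf]
    intro n
    have := h.mem_monoIdeal (γ := 2 * n) (f := f) (by rw [hf]; exact le_top)
    refine (Ideal.span_le.mpr ?_ : monoIdeal _ _ _ ≤ originIdeal k ^ n) this
    rintro _ ⟨a, ha, rfl⟩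
    obtain ⟨m, hm, hm'⟩ := exists_mono_mem_pow (k := k) h.two_le a
    simp only [one_mul] at ha
    refine Ideal.pow_le_pow_right ?_ hm
    have : (n : ℝ) ≤ m := by
      have := ha.trans hm'
      linarith
    exact_mod_cast this
  rw [Ideal.iInf_pow_eq_bot_of_isDomain _ originIdeal_ne_top] at hmem
  simpa using hmem

end Polynomial

/-! ### Existence of the valuation -/

/-- The exponents `e_i = q⁻¹ + q⁻³ + ⋯ + q^{-(2i-1)}`, encoded by `e_0 = 0` and
`q ^ 2 * e_{i+1} = q + e_i`. -/
noncomputable def hahnExp (q : ℕ) : ℕ → ℝ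
  | 0 => 0
  | (i + 1) => (q + hahnExp q i) / q ^ 2

/-- The ballot numbers, characterized by `ballot d j = ballot d (j - 1) + ballot (d - 1) (j + 1)`;
`ballot d 1` is the `d`-th Catalan number. -/
def ballot : ℕ → ℕ → ℕ
  | 0, _ => 1
  | (_ + 1), 0 => 0
  | (d + 1), (j + 1) => ballot (d + 1) j + ballot d (j + 2)

lemma sq_mul_hahnExp {q : ℕ} (hq : 2 ≤ q) (i : ℕ) :
    (q : ℝ) ^ 2 * hahnExp q (i + 1) = q + hahnExp q i := by
  have : (q : ℝ) ≠ 0 := by positivity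
  rw [hahnExp]; field_simp

lemma mul_hahnExp_one {q : ℕ} (hq : 2 ≤ q) : (q : ℝ) * hahnExp q 1 = 1 := by
  have h0 : (q : ℝ) ≠ 0 := by positivity
  have := sq_mul_hahnExp hq 0
  simp only [hahnExp, add_zero] at this ⊢
  field_simp

lemma hahnExp_strictMono {q : ℕ} (hq : 2 ≤ q) : StrictMono (hahnExp q) := by
  have h0 : (0 : ℝ) < (q : ℝ) ^ 2 := by positivity
  refine strictMono_nat_of_lt_succ fun i => ?_
  induction i with
  | zero => simp only [hahnExp]; positivity
  | succ i ih =>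
    have h1 := sq_mul_hahnExp hq i
    have h2 := sq_mul_hahnExp hq (i + 1)
    refine lt_of_mul_lt_mul_left ?_ h0.le
    linarith

section Hahn

variable {k : Type*} [Field k] {q : ℕ}

/-- The generalized power series `v = ∑ ballot (i - 1) 1 * t ^ e_i`, `i ≥ 1`. -/
noncomputable def hahnV (k : Type*) [Field k] (hq : 2 ≤ q) : HahnSeries ℝ k :=
  HahnSeries.embDomain
    (OrderEmbedding.ofStrictMono (fun i => hahnExp q (i + 1))
      fun _ _ h => hahnExp_strictMono hq (Nat.succ_lt_succ h))
    (HahnSeries.toPowerSeries.symm (PowerSeries.mk fun i => (ballot i 1 : k)))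

/-- The part of `P_{i+1}` consisting of its first `n` terms. -/
noncomputable def hahnHead (k : Type*) [Field k] (q i n : ℕ) : HahnSeries ℝ k :=
  ∑ d ∈ Finset.range n,
    HahnSeries.single ((q : ℝ) ^ i * hahnExp q (i + 1 + d)) (ballot d (i + 1) : k)

lemma le_orderTop_hahnV_sub (hq : 2 ≤ q) (n : ℕ) :
    (hahnExp q (n + 1) : WithTop ℝ) ≤ HahnSeries.addVal ℝ k (hahnV k hq - hahnHead k q 0 n) := by
  rw [HahnSeries.addVal_apply, HahnSeries.le_orderTop_iff_forall]
  intro g hg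
  have hg : g < hahnExp q (n + 1) := WithTop.coe_lt_coe.mp hg
  rw [HahnSeries.coeff_sub, sub_eq_zero, hahnHead, HahnSeries.coeff_sum]
  by_cases h : ∃ i, g = hahnExp q (i + 1)
  · obtain ⟨i, rfl⟩ := h
    have hi : i < n := by
      have := (hahnExp_strictMono hq).lt_iff_lt.mp hg
      omega
    have h1 := HahnSeries.embDomain_coeff
      (f := OrderEmbedding.ofStrictMono (fun i => hahnExp q (i + 1))
        fun _ _ h => hahnExp_strictMono hq (Nat.succ_lt_succ h))
      (x := HahnSeries.toPowerSeries.symm (PowerSeries.mk fun i => (ballot i 1 : k))) (a := i)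
    rw [HahnSeries.coeff_toPowerSeries_symm, PowerSeries.coeff_mk] at h1
    rw [Finset.sum_eq_single i]
    · simp only [pow_zero, one_mul, zero_add, add_comm 1 i, HahnSeries.coeff_single_same]
      exact h1
    · intro j _ hj
      refine HahnSeries.coeff_single_of_ne fun he => hj ?_
      simp only [pow_zero, one_mul, zero_add] at he
      have := (hahnExp_strictMono hq).injective he
      omega
    · intro h
      exact absurd (Finset.mem_range.mpr hi) h
  · rw [Finset.sum_eq_zero]
    · refine HahnSeries.embDomain_of_notMem_range ?_
      rintro ⟨i, rfl⟩
      exact h ⟨i, rfl⟩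
    · intro i _
      refine HahnSeries.coeff_single_of_ne fun he => h ⟨i, ?_⟩
      simpa [add_comm] using he

variable {p : ℕ} [Fact p.Prime] [CharP k p]

instance charP_hahnSeries : CharP (HahnSeries ℝ k) p :=
  charP_of_injective_ringHom (HahnSeries.C_injective (Γ := ℝ) (R := k)) p

lemma hahnHead_pow (i n : ℕ) : hahnHead k (p ^ 2) i n ^ p ^ 2 =
    ∑ d ∈ Finset.range n, HahnSeries.single ((p ^ 2 : ℕ) * (((p ^ 2 : ℕ) : ℝ) ^ i *
      hahnExp (p ^ 2) (i + 1 + d))) (ballot d (i + 1) : k) := by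
  rw [hahnHead, sum_pow_char_pow]
  refine Finset.sum_congr rfl fun d _ => ?_
  rw [HahnSeries.single_pow, nsmul_eq_mul]
  congr 1
  exact map_natCast (iterateFrobenius k p 2) _

/-- The series `P_{i+1}(t, v)` agrees with its head up to order `q ^ i * e_{i+1+n}`. The recursion
for the heads is the recursion for the ballot numbers, as `q`-th powers are additive. -/
theorem le_orderTop_keyPoly_sub (hq : 2 ≤ p ^ 2) : ∀ i n : ℕ,
    ((((p ^ 2 : ℕ) : ℝ) ^ i * hahnExp (p ^ 2) (i + 1 + n) : ℝ) : WithTop ℝ) ≤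
      HahnSeries.addVal ℝ k (keyPoly (p ^ 2) (HahnSeries.single 1 1) (hahnV k hq) (i + 1) -
        hahnHead k (p ^ 2) i n)
  | 0, n => by
    have := le_orderTop_hahnV_sub (k := k) hq n
    simpa [keyPoly, add_comm] using this
  | 1, n => by
    have ih := le_orderTop_keyPoly_sub hq 0 (n + 1)
    have e : keyPoly (p ^ 2) (HahnSeries.single 1 1) (hahnV k hq) (1 + 1) - hahnHead k (p ^ 2) 1 n =
        (keyPoly (p ^ 2) (HahnSeries.single 1 1) (hahnV k hq) (0 + 1) -
          hahnHead k (p ^ 2) 0 (n + 1)) ^ p ^ 2 := by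
      rw [sub_pow_char_pow, hahnHead_pow, Finset.sum_range_succ']
      simp only [keyPoly, hahnHead, pow_zero, one_mul, zero_add, ballot, add_zero,
        mul_hahnExp_one hq, Nat.cast_one, pow_one]
      rw [sub_sub, add_comm]
      simp only [add_assoc, add_comm 1]
    rw [e, AddValuation.map_pow]
    refine le_trans (le_of_eq ?_) (nsmul_le_nsmul_right ih (p ^ 2))
    rw [← WithTop.coe_nsmul, nsmul_eq_mul]
    congr 1
    rw [show 0 + 1 + (n + 1) = 1 + 1 + n by omega]
    ring
  | (i + 2), n => by
    have ih1 := le_orderTop_keyPoly_sub hq (i + 1) (n + 1)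
    have ih2 := le_orderTop_keyPoly_sub hq i (n + 1)
    have hexp : ∀ d, ((p ^ 2 : ℕ) : ℝ) * (((p ^ 2 : ℕ) : ℝ) ^ (i + 1) *
        hahnExp (p ^ 2) (i + 1 + 1 + d)) = ((p ^ 2 : ℕ) : ℝ) ^ (i + 1) +
          ((p ^ 2 : ℕ) : ℝ) ^ i * hahnExp (p ^ 2) (i + 1 + d) := by
      intro d
      have := sq_mul_hahnExp hq (i + 1 + d)
      rw [show i + 1 + 1 + d = i + 1 + d + 1 by omega]
      linear_combination ((p ^ 2 : ℕ) : ℝ) ^ i * this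
    have hmul : (HahnSeries.single 1 1 : HahnSeries ℝ k) ^ (p ^ 2) ^ (i + 1) =
        HahnSeries.single (((p ^ 2 : ℕ) : ℝ) ^ (i + 1)) 1 := by
      rw [HahnSeries.single_pow, nsmul_eq_mul, one_pow, mul_one]; push_cast; rfl
    have hhead : hahnHead k (p ^ 2) (i + 2) n = hahnHead k (p ^ 2) (i + 1) (n + 1) ^ p ^ 2 -
        (HahnSeries.single 1 1) ^ (p ^ 2) ^ (i + 1) * hahnHead k (p ^ 2) i (n + 1) := by
      rw [hahnHead_pow, hmul, hahnHead, hahnHead, Finset.mul_sum, ← Finset.sum_sub_distrib,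
        Finset.sum_range_succ']
      have hz : HahnSeries.single (((p ^ 2 : ℕ) : ℝ) * (((p ^ 2 : ℕ) : ℝ) ^ (i + 1) *
          hahnExp (p ^ 2) (i + 1 + 1 + 0))) (ballot 0 (i + 1 + 1) : k) -
          HahnSeries.single (((p ^ 2 : ℕ) : ℝ) ^ (i + 1)) 1 *
          HahnSeries.single (((p ^ 2 : ℕ) : ℝ) ^ i * hahnExp (p ^ 2) (i + 1 + 0))
            (ballot 0 (i + 1) : k) = 0 := by
        rw [HahnSeries.single_mul_single, hexp, one_mul, sub_eq_zero]
        simp [ballot]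
      rw [hz, add_zero]
      refine Finset.sum_congr rfl fun d _ => ?_
      rw [HahnSeries.single_mul_single, ← hexp, one_mul, ← HahnSeries.single_sub]
      congr 1
      · ring_nf
      · rw [ballot]; push_cast; ring_nf
    have e : keyPoly (p ^ 2) (HahnSeries.single 1 1) (hahnV k hq) (i + 2 + 1) -
        hahnHead k (p ^ 2) (i + 2) n =
        (keyPoly (p ^ 2) (HahnSeries.single 1 1) (hahnV k hq) (i + 1 + 1) -
          hahnHead k (p ^ 2) (i + 1) (n + 1)) ^ p ^ 2 -
        (HahnSeries.single 1 1) ^ (p ^ 2) ^ (i + 1) *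
        (keyPoly (p ^ 2) (HahnSeries.single 1 1) (hahnV k hq) (i + 1) -
          hahnHead k (p ^ 2) i (n + 1)) := by
      rw [sub_pow_char_pow, hhead, show i + 2 + 1 = i + 3 from rfl, keyPoly]
      ring
    rw [e]
    refine AddValuation.map_le_sub _ ?_ ?_
    · rw [AddValuation.map_pow]
      refine le_trans (le_of_eq ?_) (nsmul_le_nsmul_right ih1 (p ^ 2))
      rw [← WithTop.coe_nsmul, nsmul_eq_mul]
      congr 1
      rw [show i + 1 + 1 + (n + 1) = i + 2 + 1 + n by omega]
      ring
    · rw [AddValuation.map_mul, hmul, HahnSeries.addVal_apply (x := HahnSeries.single _ _),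
        HahnSeries.orderTop_single one_ne_zero]
      refine le_trans (le_of_eq ?_) (add_le_add_right ih2 _)
      rw [← WithTop.coe_add, ← hexp]
      congr 1
      rw [show i + 1 + 1 + (n + 1) = i + 2 + 1 + n by omega]
      ring

lemma addVal_keyPoly (hq : 2 ≤ p ^ 2) (i : ℕ) :
    HahnSeries.addVal ℝ k (keyPoly (p ^ 2) (HahnSeries.single 1 1) (hahnV k hq) (i + 1)) =
      ((((p ^ 2 : ℕ) : ℝ) ^ i * hahnExp (p ^ 2) (i + 1) : ℝ) : WithTop ℝ) := by
  have h := le_orderTop_keyPoly_sub (k := k) hq i 1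
  have hh : HahnSeries.addVal ℝ k (hahnHead k (p ^ 2) i 1) =
      ((((p ^ 2 : ℕ) : ℝ) ^ i * hahnExp (p ^ 2) (i + 1) : ℝ) : WithTop ℝ) := by
    rw [hahnHead, Finset.sum_range_one, HahnSeries.addVal_apply, ballot, Nat.cast_one,
      HahnSeries.orderTop_single one_ne_zero, add_zero]
  rw [← hh]
  refine AddValuation.map_eq_of_lt_sub _ (lt_of_lt_of_le ?_ h)
  rw [hh]
  refine WithTop.coe_lt_coe.mpr (mul_lt_mul_of_pos_left ?_ ?_)
  · exact hahnExp_strictMono hq (by omega)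
  · have : 0 < p ^ 2 := by omega
    positivity

open MvPolynomial in
/-- The valuation exists: take the order in `t` after substituting `u = t` and the series `hahnV`
for `v`. -/
theorem exists_isDeterminedByP (k : Type*) [Field k] (K : Type*) [Field K]
    [Algebra (MvPolynomial (Fin 2) k) K] [IsFractionRing (MvPolynomial (Fin 2) k) K]
    {p : ℕ} [hp : Fact p.Prime] [CharP k p] :
    ∃ ν : AddValuation K (WithTop ℝ), IsDeterminedByP k p ν := by
  have hq : 2 ≤ p ^ 2 := by nlinarith [hp.out.two_le]
  have hq0 : (0 : ℝ) < ((p ^ 2 : ℕ) : ℝ) := by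
    have : 0 < p ^ 2 := by omega
    positivity
  let φ : MvPolynomial (Fin 2) k →+* HahnSeries ℝ k :=
    eval₂Hom HahnSeries.C ![HahnSeries.single 1 1, hahnV k hq]
  have hφ0 : φ (X 0) = HahnSeries.single 1 1 := by simp [φ]
  have hφ1 : φ (X 1) = hahnV k hq := by simp [φ]
  have hφC : ∀ c, φ (C c) = HahnSeries.C c := by simp [φ]
  let ν₀ := (HahnSeries.addVal ℝ k).comap φ
  have hC : ∀ c, c ≠ 0 → ν₀ (C c) = 0 := by
    intro c hc
    show HahnSeries.addVal ℝ k (φ (C c)) = 0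
    rw [hφC, HahnSeries.addVal_apply, HahnSeries.C_apply, HahnSeries.orderTop_single hc]
    rfl
  have hu : ν₀ (X 0) = 1 := by
    show HahnSeries.addVal ℝ k (φ (X 0)) = 1
    rw [hφ0, HahnSeries.addVal_apply, HahnSeries.orderTop_single one_ne_zero]
    rfl
  have hjump : ∀ i, ν₀ (keyPoly (p ^ 2) (X 0) (X 1) (i + 1) ^ p ^ 2) <
      ν₀ (keyPoly (p ^ 2) (X 0) (X 1) (i + 2)) := by
    intro i
    show HahnSeries.addVal ℝ k (φ _) < HahnSeries.addVal ℝ k (φ _)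
    rw [map_pow, map_keyPoly, map_keyPoly, hφ0, hφ1, AddValuation.map_pow, addVal_keyPoly,
      addVal_keyPoly, ← WithTop.coe_nsmul, nsmul_eq_mul]
    refine WithTop.coe_lt_coe.mpr ?_
    rw [← mul_assoc, ← pow_succ']
    exact mul_lt_mul_of_pos_left (hahnExp_strictMono hq (by omega)) (pow_pos hq0 _)
  have hval := valuation_keyPoly hq ν₀ (u := X 0) (v := X 1) hu hjump
  have hkey := isKeySequence_polynomial hq ν₀ hC hval
  have hinj : Function.Injective φ := by
    rw [injective_iff_map_eq_zero]
    intro f hf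
    refine eq_zero_of_valuation_eq_top hkey (?_ : HahnSeries.addVal ℝ k (φ f) = ⊤)
    rw [hf, AddValuation.map_zero]
  let ψ : K →+* HahnSeries ℝ k := IsFractionRing.lift hinj
  have hψ : ∀ f, ψ (algebraMap _ K f) = φ f := fun f => IsFractionRing.lift_algebraMap hinj f
  refine ⟨(HahnSeries.addVal ℝ k).comap ψ, fun c hc => ?_, ?_, fun i hi => ?_⟩
  · show HahnSeries.addVal ℝ k (ψ _) = 0
    rw [hψ]; exact hC c hc
  · show HahnSeries.addVal ℝ k (ψ _) = 1
    rw [hψ]; exact hu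
  · obtain ⟨i, rfl⟩ := Nat.exists_eq_add_of_le' hi
    show HahnSeries.addVal ℝ k (ψ _) < HahnSeries.addVal ℝ k (ψ _)
    rw [P_eq_keyPoly, P_eq_keyPoly, ← map_keyPoly, ← map_keyPoly, ← map_pow, hψ, hψ]
    exact hjump i

end Hahn

/-! ### Localization at the center of a valuation -/

section Stage

variable {K : Type*} [Field K]

lemma ne_zero_of_valuation_eq_zero {ν : AddValuation K (WithTop ℝ)} {x : K} (h : ν x = 0) :
    x ≠ 0 := by
  rintro rfl
  simp at h

lemma valuation_mul_pos {ν : AddValuation K (WithTop ℝ)} {x y : K} (hx : 0 ≤ ν x)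
    (hy : 0 < ν y) : 0 < ν (x * y) := by
  rw [ν.map_mul]
  exact hy.trans_le (le_add_of_nonneg_left hx)

lemma valuation_div_add_cancel (ν : AddValuation K (WithTop ℝ)) (x : K) {y : K} (hy : y ≠ 0) :
    ν (x / y) + ν y = ν x := by
  rw [← ν.map_mul, div_mul_cancel₀ _ hy]

lemma valuation_div_nonneg {ν : AddValuation K (WithTop ℝ)} {x y : K} (hy : y ≠ 0)
    (h : ν y ≤ ν x) : 0 ≤ ν (x / y) := by
  rw [← valuation_div_add_cancel ν x hy] at h
  have hy' : ν y ≠ ⊤ := ν.ne_top_iff.mpr hy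
  by_contra hlt
  exact absurd h (not_le.mpr (by simpa using WithTop.add_lt_add_right hy' (not_le.mp hlt)))

lemma valuation_div_eq_zero {ν : AddValuation K (WithTop ℝ)} {x y : K} (hy : y ≠ 0)
    (h : ν x = ν y) : ν (x / y) = 0 := by
  have hx : x ≠ 0 := by
    rw [← ν.ne_top_iff, h, ν.ne_top_iff]
    exact hy
  refine le_antisymm ?_ (valuation_div_nonneg hy h.ge)
  have := valuation_div_nonneg hx h.le
  rw [← inv_div, ν.map_inv] at this
  revert this
  have hne : ν (x / y) ≠ ⊤ := ν.ne_top_iff.mpr (div_ne_zero hx hy)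
  generalize ν (x / y) = z at hne
  intro hz
  lift z to ℝ using hne
  have hz' : (0 : ℝ) ≤ -z := by exact_mod_cast hz
  exact_mod_cast (by linarith : z ≤ 0)

lemma le_localizeAtCenter (ν : AddValuation K (WithTop ℝ)) (B : Subring K) :
    B ≤ localizeAtCenter ν B :=
  fun a ha => ⟨a, ha, 1, B.one_mem, by simp, by simp⟩

lemma inv_mem_localizeAtCenter {ν : AddValuation K (WithTop ℝ)} {B : Subring K} {z : K}
    (hz : z ∈ localizeAtCenter ν B) (h : ν z = 0) : z⁻¹ ∈ localizeAtCenter ν B := by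
  obtain ⟨a, ha, b, hb, hb0, rfl⟩ := hz
  refine ⟨b, hb, a, ha, ?_, by rw [inv_div]⟩
  rw [← valuation_div_add_cancel ν a (ne_zero_of_valuation_eq_zero hb0), h, hb0, add_zero]

lemma localizeAtCenter_le {ν : AddValuation K (WithTop ℝ)} {B E : Subring K} (h : B ≤ E)
    (hE : ∀ z ∈ E, ν z = 0 → z⁻¹ ∈ E) : localizeAtCenter ν B ≤ E := by
  rintro _ ⟨a, ha, b, hb, hb0, rfl⟩
  rw [div_eq_mul_inv]
  exact E.mul_mem (h ha) (hE b (h hb) hb0)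

lemma le_quadraticTransform (ν : AddValuation K (WithTop ℝ)) (A : Subring K) :
    A ≤ quadraticTransform ν A := fun _ ha =>
  le_localizeAtCenter ν _ (Subring.subset_closure (Or.inl ha))

/-! ### Stages of the sequence of quadratic transforms -/

/-- `A` is a local ring in which `ν` is centered, the constants `κ c` form a coefficient field of
`A`, and the maximal ideal is generated by `s` and `t`. Locality is expressed by `inv_mem`: the
units are the elements of value zero. -/
structure IsStage {k : Type*} [Field k] (κ : k →+* K) (ν : AddValuation K (WithTop ℝ))
    (A : Subring K) (s t : K) : Prop where
  val_const : ∀ c, c ≠ 0 → ν (κ c) = 0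
  const_mem : ∀ c, κ c ∈ A
  left_mem : s ∈ A
  right_mem : t ∈ A
  left_pos : 0 < ν s
  right_pos : 0 < ν t
  nonneg : ∀ a ∈ A, 0 ≤ ν a
  inv_mem : ∀ a ∈ A, ν a = 0 → a⁻¹ ∈ A
  decomp : ∀ a ∈ A, ∃ c, ∃ b ∈ A, ∃ d ∈ A, a = κ c + b * s + d * t

variable {k : Type*} [Field k] {κ : k →+* K} {ν : AddValuation K (WithTop ℝ)} {A : Subring K}
  {s t : K}

lemma pos_combination (hs : 0 < ν s) (ht : 0 < ν t) {b d : K} (hb : 0 ≤ ν b) (hd : 0 ≤ ν d) :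
    0 < ν (b * s + d * t) :=
  ν.map_lt_add (valuation_mul_pos hb hs) (valuation_mul_pos hd ht)

namespace IsStage

lemma isUnit_iff (h : IsStage κ ν A s t) (a : A) : IsUnit a ↔ ν (a : K) = 0 := by
  constructor
  · intro ha
    obtain ⟨b, hb⟩ := ha.exists_right_inv
    have h1 : ν (a : K) + ν (b : K) = 0 := by
      rw [← ν.map_mul, ← Subring.coe_mul, hb]; simp
    refine le_antisymm ?_ (h.nonneg a a.2)
    rw [← h1]
    exact le_add_of_nonneg_right (h.nonneg b b.2)
  · intro ha
    refine IsUnit.of_mul_eq_one (⟨(a : K)⁻¹, h.inv_mem a a.2 ha⟩ : A) (Subtype.ext ?_)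
    exact mul_inv_cancel₀ (ne_zero_of_valuation_eq_zero ha)

lemma mem_nonunits_iff (h : IsStage κ ν A s t) (a : A) : a ∈ nonunits A ↔ 0 < ν (a : K) := by
  rw [_root_.mem_nonunits_iff, h.isUnit_iff, lt_iff_le_and_ne, and_iff_right (h.nonneg a a.2),
    ne_comm]

lemma mem_nonunitSet_iff (h : IsStage κ ν A s t) (a : K) :
    a ∈ nonunitSet A ↔ a ∈ A ∧ 0 < ν a := by
  constructor
  · rintro ⟨b, hb, rfl⟩
    exact ⟨b.2, (h.mem_nonunits_iff b).mp hb⟩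
  · rintro ⟨ha, ha'⟩
    exact ⟨⟨a, ha⟩, (h.mem_nonunits_iff ⟨a, ha⟩).mpr ha', rfl⟩

lemma isCenteredIn (h : IsStage κ ν A s t) : IsCenteredIn ν A := by
  refine ⟨IsLocalRing.of_nonunits_add fun a b ha hb => ?_, fun a =>
    ⟨h.nonneg a a.2, (h.mem_nonunits_iff a).symm⟩⟩
  rw [h.mem_nonunits_iff] at *
  exact ν.map_lt_add ha hb

/-- The maximal ideal is generated by `s` and `t`. -/
lemma exists_of_pos (h : IsStage κ ν A s t) {a : K} (ha : a ∈ A) (hpos : 0 < ν a) :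
    ∃ b ∈ A, ∃ d ∈ A, a = b * s + d * t := by
  obtain ⟨c, b, hb, d, hd, rfl⟩ := h.decomp a ha
  refine ⟨b, hb, d, hd, ?_⟩
  have hpos' := pos_combination h.left_pos h.right_pos (h.nonneg b hb) (h.nonneg d hd)
  rcases eq_or_ne c 0 with rfl | hc
  · simp
  · exfalso
    rw [add_assoc, ν.map_add_eq_of_lt_left (by rwa [h.val_const c hc]), h.val_const c hc] at hpos
    exact lt_irrefl _ hpos

lemma symm (h : IsStage κ ν A s t) : IsStage κ ν A t s where
  val_const := h.val_const
  const_mem := h.const_mem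
  left_mem := h.right_mem
  right_mem := h.left_mem
  left_pos := h.right_pos
  right_pos := h.left_pos
  nonneg := h.nonneg
  inv_mem := h.inv_mem
  decomp := fun a ha => by
    obtain ⟨c, b, hb, d, hd, e⟩ := h.decomp a ha
    exact ⟨c, d, hd, b, hb, by rw [e]; ring⟩

lemma right_le (h : IsStage κ ν A s t) (hst : ν t ≤ ν s) {a : K} (ha : a ∈ nonunitSet A) :
    ν t ≤ ν a := by
  rw [h.mem_nonunitSet_iff] at ha
  obtain ⟨b, hb, d, hd, rfl⟩ := h.exists_of_pos ha.1 ha.2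
  refine ν.map_le_add ?_ ?_
  · rw [ν.map_mul]; exact hst.trans (le_add_of_nonneg_left (h.nonneg b hb))
  · rw [ν.map_mul]; exact le_add_of_nonneg_left (h.nonneg d hd)

lemma div_mem_quadraticTransform (h : IsStage κ ν A s t) (ht : t ≠ 0) (hst : ν t ≤ ν s) :
    s / t ∈ quadraticTransform ν A :=
  le_localizeAtCenter ν _ (Subring.subset_closure (Or.inr
    ⟨t, (h.mem_nonunitSet_iff t).mpr ⟨h.right_mem, h.right_pos⟩, s,
      (h.mem_nonunitSet_iff s).mpr ⟨h.left_mem, h.left_pos⟩, ht,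
      fun _ hw => h.right_le hst hw, rfl⟩))

/-- The quadratic transform is the smallest ring which contains `A` and `s / t` and in which
the elements of value zero are invertible. -/
lemma quadraticTransform_le (h : IsStage κ ν A s t) (ht : t ≠ 0) (hst : ν t ≤ ν s)
    {E : Subring K} (hA : A ≤ E) (hE : ∀ z ∈ E, ν z = 0 → z⁻¹ ∈ E) (hdiv : s / t ∈ E) :
    quadraticTransform ν A ≤ E := by
  have key : ∀ a ∈ nonunitSet A, a / t ∈ E := by
    intro a ha
    rw [h.mem_nonunitSet_iff] at ha
    obtain ⟨b, hb, d, hd, rfl⟩ := h.exists_of_pos ha.1 ha.2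
    have e : (b * s + d * t) / t = b * (s / t) + d := by field_simp
    rw [e]
    exact E.add_mem (E.mul_mem (hA hb) hdiv) (hA hd)
  refine localizeAtCenter_le (Subring.closure_le.mpr ?_) hE
  rintro z (hz | ⟨x, hx, y, hy, hx0, hmin, rfl⟩)
  · exact hA hz
  have hx' : ν (x / t) = 0 := valuation_div_eq_zero ht (le_antisymm
    (hmin t ((h.mem_nonunitSet_iff t).mpr ⟨h.right_mem, h.right_pos⟩)) (h.right_le hst hx))
  have e : y / x = (y / t) * (x / t)⁻¹ := by field_simp
  rw [e]
  exact E.mul_mem (key y hy) (hE _ (key x hx) hx')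

/-- If `t` has the smaller value, and `w = α + ρ * (s / t)` has positive value, where `ρ` is a
unit, then the maximal ideal of the quadratic transform is generated by `t` and `w`. -/
theorem quadraticTransform (h : IsStage κ ν A s t) (ht : t ≠ 0) (hst : ν t ≤ ν s) {α ρ w : K}
    (hα : α ∈ A) (hρ : ρ ∈ A) (hρ0 : ν ρ = 0) (hw : w = α + ρ * (s / t)) (hwpos : 0 < ν w) :
    IsStage κ ν (quadraticTransform ν A) t w := by
  let D : Subring K := Subring.closure ((A : Set K) ∪ {w})
  have hAD : A ≤ D := fun a ha => Subring.subset_closure (Or.inl ha)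
  have hwD : w ∈ D := Subring.subset_closure (Or.inr rfl)
  have hρne := ne_zero_of_valuation_eq_zero hρ0
  have hdivD : s / t ∈ D := by
    have e : s / t = (w - α) * ρ⁻¹ := by rw [hw]; field_simp; ring
    rw [e]
    exact D.mul_mem (D.sub_mem hwD (hAD hα)) (hAD (h.inv_mem ρ hρ hρ0))
  have hDnonneg : ∀ z ∈ D, 0 ≤ ν z := by
    intro z hz
    induction hz using Subring.closure_induction with
    | mem x hx =>
      rcases hx with hx | rfl
      exacts [h.nonneg x hx, hwpos.le]
    | zero => simp
    | one => simp
    | add x y _ _ hx hy => exact ν.map_le_add hx hy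
    | neg x _ hx => rwa [ν.map_neg]
    | mul x y _ _ hx hy => rw [ν.map_mul]; exact add_nonneg hx hy
  have hDdec : ∀ z ∈ D, ∃ c, ∃ b ∈ D, ∃ d ∈ D, z = κ c + b * t + d * w := by
    intro z hz
    induction hz using Subring.closure_induction with
    | mem x hx =>
      rcases hx with hx | rfl
      · obtain ⟨c, b, hb, d, hd, rfl⟩ := h.decomp x hx
        refine ⟨c, b * (s / t) + d, D.add_mem (D.mul_mem (hAD hb) hdivD) (hAD hd), 0,
          D.zero_mem, ?_⟩
        field_simp
        ring
      · exact ⟨0, 0, D.zero_mem, 1, D.one_mem, by simp⟩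
    | zero => exact ⟨0, 0, D.zero_mem, 0, D.zero_mem, by simp⟩
    | one => exact ⟨1, 0, D.zero_mem, 0, D.zero_mem, by simp⟩
    | add x y _ _ hx hy =>
      obtain ⟨c, b, hb, d, hd, rfl⟩ := hx
      obtain ⟨c', b', hb', d', hd', rfl⟩ := hy
      exact ⟨c + c', b + b', D.add_mem hb hb', d + d', D.add_mem hd hd', by rw [map_add]; ring⟩
    | neg x _ hx =>
      obtain ⟨c, b, hb, d, hd, rfl⟩ := hx
      exact ⟨-c, -b, D.neg_mem hb, -d, D.neg_mem hd, by rw [map_neg]; ring⟩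
    | mul x y hxD hyD hx hy =>
      obtain ⟨c, b, hb, d, hd, hx⟩ := hx
      obtain ⟨c', b', hb', d', hd', hy⟩ := hy
      refine ⟨c * c', b * y + κ c * b', D.add_mem (D.mul_mem hb hyD)
        (D.mul_mem (hAD (h.const_mem c)) hb'), d * y + κ c * d', D.add_mem (D.mul_mem hd hyD)
        (D.mul_mem (hAD (h.const_mem c)) hd'), ?_⟩
      rw [map_mul]
      linear_combination y * hx + κ c * hy
  have hQ : QuadTransform.quadraticTransform ν A = localizeAtCenter ν D := by
    refine le_antisymm (h.quadraticTransform_le ht hst (hAD.trans (le_localizeAtCenter ν D))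
      (fun z hz => inv_mem_localizeAtCenter hz) (le_localizeAtCenter ν D hdivD))
      (localizeAtCenter_le (Subring.closure_le.mpr ?_) fun z hz => inv_mem_localizeAtCenter hz)
    rintro z (hz | rfl)
    · exact le_quadraticTransform ν A hz
    · have hA := le_quadraticTransform ν A
      rw [hw]
      exact add_mem (hA hα) (mul_mem (hA hρ) (h.div_mem_quadraticTransform ht hst))
  rw [hQ]
  have hDE := le_localizeAtCenter ν D
  refine
    { val_const := h.val_const
      const_mem := fun c => hDE (hAD (h.const_mem c))
      left_mem := hDE (hAD h.right_mem)
      right_mem := hDE hwD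
      left_pos := h.right_pos
      right_pos := hwpos
      nonneg := ?_
      inv_mem := fun a ha => inv_mem_localizeAtCenter ha
      decomp := ?_ }
  · rintro _ ⟨a, ha, b, hb, hb0, rfl⟩
    rw [ν.map_div, hb0, sub_zero]
    exact hDnonneg a ha
  · rintro _ ⟨a, ha, b, hb, hb0, rfl⟩
    have hbinv : b⁻¹ ∈ localizeAtCenter ν D :=
      inv_mem_localizeAtCenter (hDE hb) hb0
    have hbne := ne_zero_of_valuation_eq_zero hb0
    obtain ⟨c, x, hx, y, hy, ea⟩ := hDdec a ha
    obtain ⟨c', x', hx', y', hy', eb⟩ := hDdec b hb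
    have hc' : c' ≠ 0 := by
      rintro rfl
      have := pos_combination h.right_pos hwpos (hDnonneg x' hx') (hDnonneg y' hy')
      rw [eb, map_zero, zero_add] at hb0
      exact this.ne' hb0
    have hκ : κ (c / c') ∈ localizeAtCenter ν D := hDE (hAD (h.const_mem _))
    refine ⟨c / c', (x - κ (c / c') * x') * b⁻¹, mul_mem (sub_mem (hDE hx) (mul_mem hκ (hDE hx')))
      hbinv, (y - κ (c / c') * y') * b⁻¹, mul_mem (sub_mem (hDE hy) (mul_mem hκ (hDE hy')))
      hbinv, ?_⟩
    have e : κ (c / c') * κ c' = κ c := by rw [← map_mul, div_mul_cancel₀ _ hc']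
    field_simp
    linear_combination ea - κ (c / c') * eb - e

/-- If the generator `s` cannot be omitted, it is irreducible: a product of two elements of the
ideal `(s, t)` is a multiple of `s` by a nonunit plus a multiple of `t`. -/
lemma irreducible_left (h : IsStage κ ν A s t) (hst : ¬∃ a ∈ A, s = a * t) :
    Irreducible (⟨s, h.left_mem⟩ : A) := by
  constructor
  · rw [h.isUnit_iff]
    exact h.left_pos.ne'
  · intro a b hab
    by_contra hcon
    rw [not_or] at hcon
    have ha := (h.mem_nonunits_iff a).mp hcon.1
    have hb := (h.mem_nonunits_iff b).mp hcon.2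
    have hab' : s = a * b := congrArg Subtype.val hab
    obtain ⟨x, hx, y, hy, ea⟩ := h.exists_of_pos a.2 ha
    obtain ⟨x', hx', y', hy', eb⟩ := h.exists_of_pos b.2 hb
    have hm : 0 < ν (x * b + y * x' * t) := ν.map_lt_add
      (valuation_mul_pos (h.nonneg x hx) hb)
      (valuation_mul_pos (h.nonneg _ (mul_mem hy hx')) h.right_pos)
    have hu : ν (1 - (x * b + y * x' * t)) = 0 := by
      rw [ν.map_sub_eq_of_lt_left (by rwa [ν.map_one]), ν.map_one]
    have huA : 1 - (x * b + y * x' * t) ∈ A :=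
      sub_mem A.one_mem (add_mem (mul_mem hx b.2) (mul_mem (mul_mem hy hx') h.right_mem))
    refine hst ⟨y * y' * t * (1 - (x * b + y * x' * t))⁻¹,
      mul_mem (mul_mem (mul_mem hy hy') h.right_mem) (h.inv_mem _ huA hu), ?_⟩
    have hne := ne_zero_of_valuation_eq_zero hu
    have e : s * (1 - (x * b + y * x' * t)) = y * y' * t * t := by
      linear_combination hab' + (b : K) * ea + y * t * eb
    rw [mul_right_comm, ← e, mul_inv_cancel_right₀ hne]

/-- If the maximal ideal is generated by one element then all values are multiples of
one value. -/
lemma exists_nsmul_of_principal (h : IsStage κ ν A s t) (ht : t ≠ 0) (hst : ∃ a ∈ A, s = a * t)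
    {z : K} (hz : z ∈ A) (hz0 : z ≠ 0) : ∃ n : ℕ, ν z = n • ν t := by
  obtain ⟨a₀, ha₀, rfl⟩ := hst
  obtain ⟨T, hT⟩ := WithTop.ne_top_iff_exists.mp (ν.ne_top_iff.mpr ht)
  have hTpos : 0 < T := by
    have := h.right_pos
    rw [← hT] at this
    exact_mod_cast this
  have key : ∀ n : ℕ, ∀ z ∈ A, z ≠ 0 → ν z < ((n * T : ℝ) : WithTop ℝ) →
      ∃ n : ℕ, ν z = n • ν t := by
    intro n
    induction n with
    | zero =>
      intro z hz _ hlt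
      exact absurd (h.nonneg z hz) (not_le.mpr (by simpa using hlt))
    | succ n ih =>
      intro z hz hz0 hlt
      rcases (h.nonneg z hz).eq_or_lt with h0 | hpos
      · exact ⟨0, by rw [zero_smul, h0]⟩
      obtain ⟨b, hb, d, hd, rfl⟩ := h.exists_of_pos hz hpos
      have e : b * (a₀ * t) + d * t = (b * a₀ + d) * t := by ring
      rw [e] at hz0 hlt ⊢
      rw [ν.map_mul, ← hT] at hlt
      have hne : b * a₀ + d ≠ 0 := left_ne_zero_of_mul hz0
      obtain ⟨m, hm⟩ := ih _ (add_mem (mul_mem hb ha₀) hd) hne (by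
        have := ν.ne_top_iff.mpr hne
        revert hlt
        generalize ν (b * a₀ + d) = x at this
        intro hlt
        lift x to ℝ using this
        have hlt' : x + T < (n + 1 : ℕ) * T := by exact_mod_cast hlt
        push_cast at hlt'
        exact_mod_cast (by linarith : x < n * T))
      exact ⟨m + 1, by rw [ν.map_mul, hm, succ_nsmul]⟩
  obtain ⟨Z, hZ⟩ := WithTop.ne_top_iff_exists.mp (ν.ne_top_iff.mpr hz0)
  obtain ⟨n, hn⟩ := exists_nat_gt (Z / T)
  refine key n z hz hz0 ?_
  rw [← hZ]
  exact WithTop.coe_lt_coe.mpr ((div_lt_iff₀ hTpos).mp hn)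

end IsStage

end Stage

/-! ### Polynomial coordinates and unique factorization -/

open MvPolynomial

section Coordinates

variable {k K : Type*} [Field k] [Field K]

/-- Evaluation of polynomials in two variables at `x, y ∈ K`, with coefficients mapped by `κ`. -/
noncomputable def coordHom (κ : k →+* K) (x y : K) : MvPolynomial (Fin 2) k →+* K :=
  eval₂Hom κ ![x, y]

variable {κ : k →+* K} {x y : K}

@[simp] lemma coordHom_C (c : k) : coordHom κ x y (C c) = κ c := by simp [coordHom]
@[simp] lemma coordHom_X_zero : coordHom κ x y (X 0) = x := by simp [coordHom]
@[simp] lemma coordHom_X_one : coordHom κ x y (X 1) = y := by simp [coordHom]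

lemma ringHom_eq_coordHom (φ : MvPolynomial (Fin 2) k →+* K) :
    φ = coordHom (φ.comp C) (φ (X 0)) (φ (X 1)) := by
  refine MvPolynomial.ringHom_ext (by simp) fun i => ?_
  rcases Fin.exists_fin_two.mp ⟨i, rfl⟩ with h | h <;> rw [h] <;> simp

/-- `x` and `y` are algebraically independent over `k`, and `A` is the localization of the
polynomial ring `k[x, y]` at the origin. -/
structure IsCoordinateRing (κ : k →+* K) (A : Subring K) (x y : K) : Prop where
  inj : Function.Injective (coordHom κ x y)
  mem_iff : ∀ z, z ∈ A ↔ ∃ f g, constantCoeff g ≠ 0 ∧ z = coordHom κ x y f / coordHom κ x y g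

lemma ne_zero_of_constantCoeff_ne_zero {f : MvPolynomial (Fin 2) k} (h : constantCoeff f ≠ 0) :
    f ≠ 0 := by
  rintro rfl
  simp at h

namespace IsCoordinateRing

variable {A : Subring K}

lemma map_ne_zero (h : IsCoordinateRing κ A x y) {f : MvPolynomial (Fin 2) k} (hf : f ≠ 0) :
    coordHom κ x y f ≠ 0 := (map_ne_zero_iff _ h.inj).mpr hf

lemma map_mem (h : IsCoordinateRing κ A x y) (f : MvPolynomial (Fin 2) k) :
    coordHom κ x y f ∈ A := (h.mem_iff _).mpr ⟨f, 1, by simp, by simp⟩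

lemma inv_map_mem (h : IsCoordinateRing κ A x y) {g : MvPolynomial (Fin 2) k}
    (hg : constantCoeff g ≠ 0) : (coordHom κ x y g)⁻¹ ∈ A :=
  (h.mem_iff _).mpr ⟨1, g, hg, by simp⟩

lemma left_mem (h : IsCoordinateRing κ A x y) : x ∈ A := by
  simpa using h.map_mem (X 0)

lemma right_mem (h : IsCoordinateRing κ A x y) : y ∈ A := by
  simpa using h.map_mem (X 1)

/-- The inverse of a polynomial without constant term is not in the ring. -/
lemma inv_map_notMem (h : IsCoordinateRing κ A x y) {f : MvPolynomial (Fin 2) k}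
    (hf0 : f ≠ 0) (hf : constantCoeff f = 0) : (coordHom κ x y f)⁻¹ ∉ A := by
  intro hmem
  obtain ⟨g, l, hl, e⟩ := (h.mem_iff _).mp hmem
  have hfe := h.map_ne_zero hf0
  have hle := h.map_ne_zero (ne_zero_of_constantCoeff_ne_zero hl)
  have e' : coordHom κ x y l = coordHom κ x y (f * g) := by
    rw [map_mul]
    field_simp at e
    rw [e]
  have e'' := congrArg constantCoeff (h.inj e')
  rw [map_mul, hf, zero_mul] at e''
  exact hl e''

lemma swap (h : IsCoordinateRing κ A x y) : IsCoordinateRing κ A y x := by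
  have e : ∀ f, coordHom κ x y (rename (Equiv.swap 0 1) f) = coordHom κ y x f := by
    intro f
    have : (coordHom κ x y).comp (rename (Equiv.swap 0 1) : _ →ₐ[k] MvPolynomial (Fin 2) k) =
        coordHom κ y x := by
      refine MvPolynomial.ringHom_ext (by simp) fun i => ?_
      rcases Fin.exists_fin_two.mp ⟨i, rfl⟩ with h | h <;> rw [h] <;> simp
    exact RingHom.congr_fun this f
  have e' : ∀ f, coordHom κ y x (rename (Equiv.swap 0 1) f) = coordHom κ x y f := by
    intro f
    rw [← e, rename_rename, ← Equiv.coe_trans, Equiv.swap_swap]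
    simp
  refine ⟨fun f g hfg => ?_, fun z => ?_⟩
  · rw [← e, ← e] at hfg
    exact rename_injective _ (Equiv.injective _) (h.inj hfg)
  · rw [h.mem_iff]
    constructor
    · rintro ⟨f, g, hg, rfl⟩
      exact ⟨rename (Equiv.swap 0 1) f, rename (Equiv.swap 0 1) g,
        by rwa [constantCoeff_rename], by rw [e', e']⟩
    · rintro ⟨f, g, hg, rfl⟩
      exact ⟨rename (Equiv.swap 0 1) f, rename (Equiv.swap 0 1) g,
        by rwa [constantCoeff_rename], by rw [e, e]⟩

/-- The ring of a coordinate system is centered at every valuation that is trivial on constants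
and positive at the coordinates. -/
lemma isStage (h : IsCoordinateRing κ A x y) {ν : AddValuation K (WithTop ℝ)}
    (hκ : ∀ c, c ≠ 0 → ν (κ c) = 0) (hx : 0 < ν x) (hy : 0 < ν y) : IsStage κ ν A x y := by
  have hnn : ∀ f, 0 ≤ ν (coordHom κ x y f) := by
    refine nonneg_polynomial (ν.comap (coordHom κ x y)) (fun c hc => ?_) fun i => ?_
    · show ν (coordHom κ x y (C c)) = 0
      rw [coordHom_C]; exact hκ c hc
    · show 0 ≤ ν (coordHom κ x y (X i))
      rcases Fin.exists_fin_two.mp ⟨i, rfl⟩ with h | h <;> rw [h] <;> simp [hx.le, hy.le]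
  have hdec : ∀ f, ∃ g l, coordHom κ x y f = κ (constantCoeff f) + coordHom κ x y g * x +
      coordHom κ x y l * y := by
    intro f
    obtain ⟨g, l, e⟩ := exists_eq_C_add f
    refine ⟨g, l, ?_⟩
    conv_lhs => rw [e]
    simp
  have hpos : ∀ f, constantCoeff f = 0 → 0 < ν (coordHom κ x y f) := by
    intro f hf
    obtain ⟨g, l, e⟩ := hdec f
    rw [e, hf, map_zero, zero_add]
    exact pos_combination hx hy (hnn g) (hnn l)
  have hzero : ∀ f, constantCoeff f ≠ 0 → ν (coordHom κ x y f) = 0 := by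
    intro f hf
    obtain ⟨g, l, e⟩ := hdec f
    rw [e, add_assoc, ν.map_add_eq_of_lt_left, hκ _ hf]
    rw [hκ _ hf]
    exact pos_combination hx hy (hnn g) (hnn l)
  refine
    { val_const := hκ
      const_mem := fun c => by simpa using h.map_mem (C c)
      left_mem := h.left_mem
      right_mem := h.right_mem
      left_pos := hx
      right_pos := hy
      nonneg := ?_
      inv_mem := ?_
      decomp := ?_ }
  · intro a ha
    obtain ⟨f, g, hg, rfl⟩ := (h.mem_iff a).mp ha
    rw [ν.map_div, hzero g hg, sub_zero]
    exact hnn f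
  · intro a ha ha0
    obtain ⟨f, g, hg, rfl⟩ := (h.mem_iff a).mp ha
    rw [ν.map_div, hzero g hg, sub_zero] at ha0
    refine (h.mem_iff _).mpr ⟨g, f, fun hf => (hpos f hf).ne' ha0, inv_div _ _⟩
  · intro a ha
    obtain ⟨f, g, hg, rfl⟩ := (h.mem_iff a).mp ha
    have hge := h.map_ne_zero (ne_zero_of_constantCoeff_ne_zero hg)
    obtain ⟨f1, f2, ef⟩ := exists_eq_C_add
      (f - C (constantCoeff f / constantCoeff g) * g)
    have hc : constantCoeff (f - C (constantCoeff f / constantCoeff g) * g) = 0 := by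
      rw [map_sub, map_mul, constantCoeff_C, div_mul_cancel₀ _ hg, sub_self]
    rw [hc] at ef
    have ef' := congrArg (coordHom κ x y) ef
    simp only [map_sub, map_mul, map_add, coordHom_C, coordHom_X_zero, coordHom_X_one,
      map_zero, zero_add] at ef'
    refine ⟨constantCoeff f / constantCoeff g, coordHom κ x y f1 / coordHom κ x y g,
      (h.mem_iff _).mpr ⟨f1, g, hg, rfl⟩, coordHom κ x y f2 / coordHom κ x y g,
      (h.mem_iff _).mpr ⟨f2, g, hg, rfl⟩, ?_⟩
    generalize κ (constantCoeff f / constantCoeff g) = c at ef' ⊢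
    field_simp
    linear_combination ef'

/-- A prime polynomial without constant term is a prime element of the ring. -/
lemma prime_map (h : IsCoordinateRing κ A x y) {f : MvPolynomial (Fin 2) k} (hf : Prime f)
    (hf0 : constantCoeff f = 0) : Prime (⟨coordHom κ x y f, h.map_mem f⟩ : A) := by
  have hfe := h.map_ne_zero hf.ne_zero
  have cancel : ∀ {g l : MvPolynomial (Fin 2) k}, constantCoeff l ≠ 0 → f ∣ g * l → f ∣ g := by
    intro g l hl hd
    refine (hf.dvd_or_dvd hd).resolve_right ?_
    rintro ⟨m, rfl⟩
    rw [map_mul, hf0, zero_mul] at hl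
    exact hl rfl
  refine ⟨fun h0 => hfe (congrArg Subtype.val h0), fun hu => ?_, ?_⟩
  · obtain ⟨b, hb⟩ := hu.exists_right_inv
    refine h.inv_map_notMem hf.ne_zero hf0 ?_
    have hb' : coordHom κ x y f * (b : K) = 1 := congrArg Subtype.val hb
    rw [inv_eq_of_mul_eq_one_right hb']
    exact b.2
  · have up : ∀ (a : A) (g l : MvPolynomial (Fin 2) k), constantCoeff l ≠ 0 →
        (a : K) = coordHom κ x y g / coordHom κ x y l → f ∣ g →
        (⟨coordHom κ x y f, h.map_mem f⟩ : A) ∣ a := by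
      rintro a g l hl ha ⟨m, rfl⟩
      refine ⟨⟨coordHom κ x y m / coordHom κ x y l, (h.mem_iff _).mpr ⟨m, l, hl, rfl⟩⟩,
        Subtype.ext ?_⟩
      rw [ha, map_mul, mul_div_assoc]
      rfl
    rintro ⟨a, ha⟩ ⟨b, hb⟩ ⟨⟨c, hc⟩, habc⟩
    have habc' : a * b = coordHom κ x y f * c := congrArg Subtype.val habc
    obtain ⟨a1, a2, ha2, ea⟩ := (h.mem_iff _).mp ha
    obtain ⟨b1, b2, hb2, eb⟩ := (h.mem_iff _).mp hb
    obtain ⟨c1, c2, hc2, ec⟩ := (h.mem_iff _).mp hc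
    have hae := h.map_ne_zero (ne_zero_of_constantCoeff_ne_zero ha2)
    have hbe := h.map_ne_zero (ne_zero_of_constantCoeff_ne_zero hb2)
    have hce := h.map_ne_zero (ne_zero_of_constantCoeff_ne_zero hc2)
    rw [ea, eb, ec] at habc'
    have e : (a1 * b1) * c2 = f * (c1 * (a2 * b2)) := by
      apply h.inj
      simp only [map_mul]
      field_simp at habc'
      linear_combination habc'
    rcases hf.dvd_or_dvd (cancel hc2 ⟨_, e⟩) with hd | hd
    · exact Or.inl (up _ a1 a2 ha2 ea hd)
    · exact Or.inr (up _ b1 b2 hb2 eb hd)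

/-- The ring is factorial, as a localization of a polynomial ring. -/
theorem prime_of_irreducible (h : IsCoordinateRing κ A x y) {a : A} (ha : Irreducible a) :
    Prime a := by
  have key : ∀ f : MvPolynomial (Fin 2) k, f ≠ 0 → ∀ a : A, Irreducible a →
      Associated a ⟨coordHom κ x y f, h.map_mem f⟩ → Prime a := by
    intro f
    induction f using UniqueFactorizationMonoid.induction_on_prime with
    | h₁ => intro h0; exact absurd rfl h0
    | h₂ f hf =>
      intro _ a ha hass
      refine absurd (hass.symm.isUnit ?_) ha.not_isUnit
      obtain ⟨g, hg⟩ := hf.exists_right_inv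
      refine IsUnit.of_mul_eq_one ⟨coordHom κ x y g, h.map_mem g⟩ (Subtype.ext ?_)
      show coordHom κ x y f * coordHom κ x y g = 1
      rw [← map_mul, hg, map_one]
    | h₃ g f hg0 hf ih =>
      intro _ a ha hass
      have e : (⟨coordHom κ x y (f * g), h.map_mem _⟩ : A) =
          ⟨coordHom κ x y f, h.map_mem f⟩ * ⟨coordHom κ x y g, h.map_mem g⟩ :=
        Subtype.ext (map_mul _ _ _)
      rw [e] at hass
      by_cases hf0 : constantCoeff f = 0
      · have hp := h.prime_map hf hf0
        rcases (hass.irreducible ha).isUnit_or_isUnit rfl with hu | hu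
        · exact absurd hu hp.not_isUnit
        · exact (hass.trans (associated_mul_unit_left _ _ hu)).symm.prime hp
      · refine ih hg0 a ha (hass.trans (associated_unit_mul_left _ _ ?_))
        refine IsUnit.of_mul_eq_one ⟨_, h.inv_map_mem hf0⟩ (Subtype.ext ?_)
        exact mul_inv_cancel₀ (h.map_ne_zero hf.ne_zero)
  obtain ⟨f, g, hg, e⟩ := (h.mem_iff a).mp a.2
  have hge := h.map_ne_zero (ne_zero_of_constantCoeff_ne_zero hg)
  have hf : f ≠ 0 := by
    rintro rfl
    rw [map_zero, zero_div] at e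
    exact ha.ne_zero (Subtype.ext e)
  have hu : IsUnit (⟨coordHom κ x y g, h.map_mem g⟩ : A) :=
    IsUnit.of_mul_eq_one ⟨_, h.inv_map_mem hg⟩ (Subtype.ext (mul_inv_cancel₀ hge))
  refine key f hf a ha ?_
  have e2 : (⟨coordHom κ x y f, h.map_mem f⟩ : A) = a * ⟨coordHom κ x y g, h.map_mem g⟩ :=
    Subtype.ext (by rw [Subring.coe_mul, e]; field_simp)
  rw [e2]
  exact (associated_mul_unit_left _ _ hu).symm

/-- `(y, x / y - α)` is algebraically independent if `(y, x)` is: `x` is algebraic over `k(y)`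
if `x / y - α` is. -/
lemma injective_coordHom_div (h : Function.Injective (coordHom κ y x)) (α : k) :
    Function.Injective (coordHom κ y (x / y - κ α)) := by
  let _ : Algebra k K := κ.toAlgebra
  have hy0 : y ≠ 0 := by
    have := (map_ne_zero_iff _ h).mpr (X_ne_zero (R := k) (0 : Fin 2))
    simpa using this
  have h' : AlgebraicIndependent k ![y, x] := algebraicIndependent_iff_injective_aeval.mpr h
  refine algebraicIndependent_iff_injective_aeval.mp
    (?_ : AlgebraicIndependent k ![y, x / y - κ α])
  rw [AlgebraicIndependent.iff_transcendental_adjoin_image 1] at h' ⊢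
  have eqOn : ∀ z w : K, ∀ j : Fin 2, j ≠ 1 → (![y, z] : Fin 2 → K) j = ![y, w] j := by
    intro z w j hj
    obtain rfl : j = 0 := by omega
    rfl
  have e1 : (fun j : {j : Fin 2 // j ≠ 1} => (![y, x / y - κ α] : Fin 2 → K) j) =
      fun j : {j : Fin 2 // j ≠ 1} => (![y, x] : Fin 2 → K) j :=
    funext fun j => eqOn _ _ j.1 j.2
  have e2 : (![y, x / y - κ α] : Fin 2 → K) '' {1}ᶜ = ![y, x] '' {1}ᶜ :=
    Set.image_congr fun j hj => eqOn _ _ j hj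
  rw [e1, e2]
  refine ⟨h'.1, fun halg => h'.2 ?_⟩
  have hymem : y ∈ Algebra.adjoin k ((![y, x] : Fin 2 → K) '' {1}ᶜ) :=
    Algebra.subset_adjoin ⟨0, by simp, rfl⟩
  have hyalg := isAlgebraic_algebraMap (A := K)
    (⟨y, hymem⟩ : Algebra.adjoin k ((![y, x] : Fin 2 → K) '' {1}ᶜ))
  have hαalg := isAlgebraic_algebraMap (A := K)
    (algebraMap k (Algebra.adjoin k ((![y, x] : Fin 2 → K) '' {1}ᶜ)) α)
  have e3 : (![y, x] : Fin 2 → K) 1 = y * ((![y, x / y - κ α] : Fin 2 → K) 1 + κ α) := by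
    simp
    field_simp
  rw [e3]
  exact hyalg.mul (halg.add hαalg)

/-- The quadratic transform of a coordinate ring is a coordinate ring. -/
theorem exists_quadraticTransform (h : IsCoordinateRing κ A x y) {ν : AddValuation K (WithTop ℝ)}
    {s t s' t' : K} (hA : IsStage κ ν A s t) (hB : IsStage κ ν (quadraticTransform ν A) s' t') :
    ∃ x' y', IsCoordinateRing κ (quadraticTransform ν A) x' y' := by
  have hpos : ∀ f, f ≠ 0 → constantCoeff f = 0 → 0 < ν (coordHom κ x y f) := by
    intro f hf0 hf
    refine lt_of_le_of_ne (hA.nonneg _ (h.map_mem f)) fun h0 => ?_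
    exact h.inv_map_notMem hf0 hf (hA.inv_mem _ (h.map_mem f) h0.symm)
  have hx : 0 < ν x := by simpa using hpos (X 0) (X_ne_zero 0) (by simp)
  have hy : 0 < ν y := by simpa using hpos (X 1) (X_ne_zero 1) (by simp)
  have hA' := h.isStage hA.val_const hx hy
  wlog hxy : ν y ≤ ν x generalizing x y
  · refine this h.swap ?_ hy hx hA'.symm (le_of_not_ge hxy)
    intro f hf0 hf
    refine lt_of_le_of_ne (hA.nonneg _ (h.swap.map_mem f)) fun h0 => ?_
    exact h.swap.inv_map_notMem hf0 hf (hA.inv_mem _ (h.swap.map_mem f) h0.symm)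
  have hy0 : y ≠ 0 := by simpa using h.map_ne_zero (X_ne_zero (R := k) (1 : Fin 2))
  have hdiv := hA'.div_mem_quadraticTransform hy0 hxy
  obtain ⟨α, b, hb, d, hd, e⟩ := hB.decomp _ hdiv
  set y' := x / y - κ α with hy'
  have hy'pos : 0 < ν y' := by
    have e2 : y' = b * s' + d * t' := by rw [hy', e]; ring
    rw [e2]
    exact pos_combination hB.left_pos hB.right_pos (hB.nonneg b hb) (hB.nonneg d hd)
  have hy'B : y' ∈ quadraticTransform ν A := sub_mem hdiv (hB.const_mem α)
  have hinj : Function.Injective (coordHom κ y y') := injective_coordHom_div h.swap.inj α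
  have hle := le_quadraticTransform ν A
  -- the localization of `k[y, y']` at the origin
  let L : Subring K :=
    { carrier := {z | ∃ f g, constantCoeff g ≠ 0 ∧ z = coordHom κ y y' f / coordHom κ y y' g}
      mul_mem' := by
        rintro _ _ ⟨f, g, hg, rfl⟩ ⟨f', g', hg', rfl⟩
        exact ⟨f * f', g * g', by simp [hg, hg'], by simp [div_mul_div_comm]⟩
      one_mem' := ⟨1, 1, by simp, by simp⟩
      add_mem' := by
        rintro _ _ ⟨f, g, hg, rfl⟩ ⟨f', g', hg', rfl⟩
        have h1 := (map_ne_zero_iff _ hinj).mpr (ne_zero_of_constantCoeff_ne_zero hg)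
        have h2 := (map_ne_zero_iff _ hinj).mpr (ne_zero_of_constantCoeff_ne_zero hg')
        exact ⟨f * g' + g * f', g * g', by simp [hg, hg'], by simp [div_add_div _ _ h1 h2]⟩
      zero_mem' := ⟨0, 1, by simp, by simp⟩
      neg_mem' := by
        rintro _ ⟨f, g, hg, rfl⟩
        exact ⟨-f, g, hg, by simp [neg_div]⟩ }
  have hL : IsCoordinateRing κ L y y' := ⟨hinj, fun z => Iff.rfl⟩
  have hLs := hL.isStage hA.val_const hy hy'pos
  suffices hBL : quadraticTransform ν A = L by
    rw [hBL]
    exact ⟨y, y', hL⟩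
  refine le_antisymm (hA'.quadraticTransform_le hy0 hxy ?_ hLs.inv_mem ?_) ?_
  · intro a ha
    obtain ⟨f, g, hg, rfl⟩ := (h.mem_iff a).mp ha
    let σ : MvPolynomial (Fin 2) k →+* MvPolynomial (Fin 2) k :=
      eval₂Hom C ![X 0 * (X 1 + C α), X 0]
    have hσ : ∀ f, coordHom κ y y' (σ f) = coordHom κ x y f := by
      intro f
      have : (coordHom κ y y').comp σ = coordHom κ x y := by
        refine MvPolynomial.ringHom_ext (by simp [σ]) fun i => ?_
        rcases Fin.exists_fin_two.mp ⟨i, rfl⟩ with h | h <;> rw [h] <;> simp [σ, hy']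
        field_simp
      exact RingHom.congr_fun this f
    have hσc : ∀ f, constantCoeff (σ f) = constantCoeff f := by
      intro f
      have : (constantCoeff (R := k) (σ := Fin 2)).comp σ = constantCoeff := by
        refine MvPolynomial.ringHom_ext (by simp [σ]) fun i => ?_
        rcases Fin.exists_fin_two.mp ⟨i, rfl⟩ with h | h <;> rw [h] <;> simp [σ]
      exact RingHom.congr_fun this f
    exact ⟨σ f, σ g, by rwa [hσc], by rw [hσ, hσ]⟩
  · have e3 : x / y = y' + κ α := by rw [hy']; ring
    rw [e3]
    exact L.add_mem hL.right_mem (hLs.const_mem α)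
  · have hmem : ∀ f, coordHom κ y y' f ∈ quadraticTransform ν A := by
      intro f
      induction f using MvPolynomial.induction_on with
      | C a => rw [coordHom_C]; exact hB.const_mem a
      | add f f' hf hf' => rw [map_add]; exact add_mem hf hf'
      | mul_X f i hf =>
        rw [map_mul]
        refine mul_mem hf ?_
        rcases Fin.exists_fin_two.mp ⟨i, rfl⟩ with h' | h' <;> rw [h']
        · simpa using hle h.right_mem
        · simpa using hy'B
    rintro _ ⟨f, g, hg, rfl⟩
    rw [div_eq_mul_inv]
    refine mul_mem (hmem f) (hB.inv_mem _ (hmem g) ?_)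
    refine le_antisymm ?_ (hB.nonneg _ (hmem g))
    have := hLs.nonneg _ (hL.inv_map_mem hg)
    have hge := hL.map_ne_zero (ne_zero_of_constantCoeff_ne_zero hg)
    refine le_of_le_of_eq (le_add_of_nonneg_right this) ?_
    rw [← ν.map_mul, mul_inv_cancel₀ hge, ν.map_one]

end IsCoordinateRing

end Coordinates

/-! ### From one free ring to the next -/

section FreeStage

variable {k K : Type*} [Field k] [Field K] {κ : k →+* K} {ν : AddValuation K (WithTop ℝ)}
  {A : Subring K} {q : ℕ}

lemma valuation_div_of_eq_coe {x y : K} {a b : ℝ} (hx : ν x = (a : WithTop ℝ))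
    (hy : ν y = (b : WithTop ℝ)) : ν (x / y) = ((a - b : ℝ) : WithTop ℝ) := by
  have hy0 : y ≠ 0 := by
    rw [← ν.ne_top_iff, hy]
    exact WithTop.coe_ne_top
  have h := valuation_div_add_cancel ν x hy0
  have hne : ν (x / y) ≠ ⊤ := by
    intro htop
    rw [htop, hx, top_add] at h
    exact WithTop.coe_ne_top h.symm
  obtain ⟨c, hc⟩ := WithTop.ne_top_iff_exists.mp hne
  rw [hx, hy, ← hc] at h
  have h' : c + b = a := by exact_mod_cast h
  rw [← hc, ← h', add_sub_cancel_right]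

lemma valuation_pow_of_eq_coe {x : K} {a : ℝ} (hx : ν x = (a : WithTop ℝ)) (n : ℕ) :
    ν (x ^ n) = ((n * a : ℝ) : WithTop ℝ) := by
  rw [ν.map_pow, hx, ← WithTop.coe_nsmul, nsmul_eq_mul]

/-- The values of a key sequence are not multiples of a single value, so the maximal ideal of
a ring containing such a sequence is not principal. -/
lemma IsStage.not_principal {s t : K} (h : IsStage κ ν A s t) (ht : t ≠ 0) (hq : 2 ≤ q) {l : ℝ}
    (hl : 0 < l) {Q : ℕ → K} (hQ : ∀ i, Q i ∈ A)
    (hval : ∀ i, ν (Q i) = ((l * keyValue q i : ℝ) : WithTop ℝ)) : ¬∃ a ∈ A, s = a * t := by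
  intro hst
  obtain ⟨T, hT⟩ := WithTop.ne_top_iff_exists.mp (ν.ne_top_iff.mpr ht)
  have hTpos : 0 < T := by
    have := h.right_pos
    rw [← hT] at this
    exact_mod_cast this
  have mult : ∀ i, ∃ n : ℕ, l * keyValue q i = n * T := by
    intro i
    have hne : Q i ≠ 0 := by
      rw [← ν.ne_top_iff, hval]
      exact WithTop.coe_ne_top
    obtain ⟨n, hn⟩ := h.exists_nsmul_of_principal ht hst (hQ i) hne
    rw [hval, ← hT, ← WithTop.coe_nsmul, nsmul_eq_mul] at hn
    exact ⟨n, WithTop.coe_injective hn⟩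
  have hq0 : (0 : ℝ) < q := by positivity
  obtain ⟨i, hi⟩ := exists_nat_gt (l / T)
  have hi' : l / T < (q : ℝ) ^ (i + 2) := by
    refine hi.trans_le ?_
    have : i < q ^ (i + 2) :=
      (Nat.lt_pow_self hq).trans_le (Nat.pow_le_pow_right (by omega) (by omega))
    exact_mod_cast this.le
  obtain ⟨n, hn⟩ := mult (i + 2)
  obtain ⟨m, hm⟩ := mult (i + 1)
  have hd := keyValue_succ_sub hq i
  have hpow : (0 : ℝ) < (q : ℝ) ^ (i + 2) := by positivity
  have e : l * (1 / (q : ℝ) ^ (i + 2)) = ((n - q * m : ℤ) : ℝ) * T := by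
    push_cast
    rw [← hd, sub_mul, mul_assoc, ← hn, ← hm]
    ring
  have hpos : 0 < ((n - q * m : ℤ) : ℝ) * T := by rw [← e]; positivity
  have hint : 0 < (n - q * m : ℤ) := by
    have := pos_of_mul_pos_left hpos hTpos.le
    exact_mod_cast this
  have hint' : (1 : ℝ) ≤ ((n - q * m : ℤ) : ℝ) := by exact_mod_cast hint
  have : T ≤ l * (1 / (q : ℝ) ^ (i + 2)) := by rw [e]; nlinarith
  rw [mul_one_div, le_div_iff₀ hpow] at this
  rw [div_lt_iff₀ hTpos] at hi'
  linarith

/-- A ring of the sequence in which the divisor of `u` is irreducible, with the sequence `Q` in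
the role of `P_k`: `u` is a unit times `Q_0 ^ e`, and the `Q_i` satisfy the recursion of the `P_i`
up to units. -/
structure IsFreeStage (κ : k →+* K) (ν : AddValuation K (WithTop ℝ)) (q : ℕ) (u : K)
    (A : Subring K) (l : ℝ) (e : ℕ) (Q : ℕ → K) : Prop where
  two_le : 2 ≤ q
  pos : 0 < l
  exp_pos : 0 < e
  stage : IsStage κ ν A (Q 0) (Q 1)
  coord : ∃ x y, IsCoordinateRing κ A x y
  mem : ∀ i, Q i ∈ A
  val : ∀ i, ν (Q i) = ((l * keyValue q i : ℝ) : WithTop ℝ)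
  rel_one : ∃ τ ∈ A, ν τ = 0 ∧ Q 1 ^ q = τ * Q 0 + Q 2
  rel : ∀ i, ∃ τ ∈ A, ν τ = 0 ∧ Q (i + 2) ^ q = τ * (Q 0 ^ q ^ (i + 1) * Q (i + 1)) + Q (i + 3)
  unit_mul : ∃ ε ∈ A, ν ε = 0 ∧ u = ε * Q 0 ^ e

namespace IsFreeStage

variable {u : K} {l : ℝ} {e : ℕ} {Q : ℕ → K}

lemma ne_zero (h : IsFreeStage κ ν q u A l e Q) (i : ℕ) : Q i ≠ 0 := by
  rw [← ν.ne_top_iff, h.val]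
  exact WithTop.coe_ne_top

lemma hasSingleComponent (h : IsFreeStage κ ν q u A l e Q) : HasSingleComponent A u := by
  obtain ⟨ε, hε, hε0, rfl⟩ := h.unit_mul
  refine ⟨mul_mem hε (pow_mem (h.mem 0) e), ⟨Q 0, h.mem 0⟩, h.stage.irreducible_left
    (h.stage.not_principal (h.ne_zero 1) h.two_le h.pos h.mem h.val), e, h.exp_pos, ?_⟩
  have hu : IsUnit (⟨ε, hε⟩ : A) := (h.stage.isUnit_iff _).mpr hε0
  exact (associated_unit_mul_left (⟨Q 0, h.mem 0⟩ ^ e : A) ⟨ε, hε⟩ hu).symm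

theorem isGeneratingSequence (h : IsFreeStage κ ν q u A l e Q) : IsGeneratingSequence ν A Q := by
  refine ⟨h.mem, fun γ hγ => ?_⟩
  obtain ⟨f₀, hf₀, rfl⟩ := hγ
  have hf₀' : (f₀ : K) ≠ 0 := fun h0 => hf₀ (Subtype.ext h0)
  obtain ⟨g, hg⟩ := WithTop.ne_top_iff_exists.mp (ν.ne_top_iff.mpr hf₀')
  rw [← hg]
  let Q' : ℕ → A := fun i => ⟨Q i, h.mem i⟩
  have hkey : IsKeySequence (κ.codRestrict A h.stage.const_mem) (ν.comap A.subtype) q l Q' := by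
    refine
      { two_le := h.two_le
        pos := h.pos
        const := h.stage.val_const
        nonneg := fun r => h.stage.nonneg r r.2
        decomp := fun r => ?_
        val := h.val
        rel_one := ?_
        rel := fun i => ?_ }
    · obtain ⟨c, b, hb, d, hd, e⟩ := h.stage.decomp r r.2
      exact ⟨c, ⟨b, hb⟩, ⟨d, hd⟩, Subtype.ext e⟩
    · obtain ⟨τ, hτ, -, e⟩ := h.rel_one
      exact ⟨⟨τ, hτ⟩, Subtype.ext e⟩
    · obtain ⟨τ, hτ, -, e⟩ := h.rel i
      exact ⟨⟨τ, hτ⟩, Subtype.ext e⟩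
  have hsum : ∀ a : ℕ →₀ ℕ, (a.sum fun i n => n • ν (Q i)) =
      ((wt (fun i => l * keyValue q i) a : ℝ) : WithTop ℝ) := by
    intro a
    rw [wt, Finsupp.sum, Finsupp.sum, WithTop.coe_sum]
    refine Finset.sum_congr rfl fun i _ => ?_
    rw [h.val, ← WithTop.coe_nsmul, nsmul_eq_mul]
  have hideal : Ideal.span {z : A | ∃ a : ℕ →₀ ℕ, (g : WithTop ℝ) ≤ (a.sum fun i n => n • ν (Q i)) ∧
      z = a.prod fun i n => (⟨Q i, h.mem i⟩ : A) ^ n} =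
      monoIdeal Q' (fun i => l * keyValue q i) g := by
    simp only [hsum, WithTop.coe_le_coe]
    rfl
  rw [hideal]
  ext f
  exact ⟨fun hf => hkey.mem_monoIdeal hf, fun hf =>
    le_valuation_of_mem_monoIdeal _ hkey.nonneg hkey.val hf⟩

lemma val_one (h : IsFreeStage κ ν q u A l e Q) : ν (Q 1) = ((l / q : ℝ) : WithTop ℝ) := by
  rw [h.val, keyValue_one, mul_one_div]

lemma val_div (h : IsFreeStage κ ν q u A l e Q) (j : ℕ) :
    ν (Q 0 / Q 1 ^ j) = ((l - j * (l / q) : ℝ) : WithTop ℝ) := by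
  refine valuation_div_of_eq_coe ?_ (valuation_pow_of_eq_coe h.val_one j)
  rw [h.val, keyValue_zero, mul_one]

lemma val_one_le (h : IsFreeStage κ ν q u A l e Q) {j : ℕ} (hj : j < q) :
    ν (Q 1) ≤ ν (Q 0 / Q 1 ^ j) := by
  rw [h.val_one, h.val_div, WithTop.coe_le_coe]
  have h0 : (0 : ℝ) < q := by have := h.two_le; positivity
  have hj' : ((j + 1 : ℕ) : ℝ) ≤ q := by exact_mod_cast hj
  have h1 : l / q * q = l := div_mul_cancel₀ _ h0.ne'
  have h2 : 0 < l / q := div_pos h.pos h0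
  push_cast at hj'
  nlinarith

/-- For `j < q` the maximal ideal of the `j`-th quadratic transform is generated by
`Q_0 / Q_1 ^ j` and `Q_1`. -/
lemma isStage_iterate (h : IsFreeStage κ ν q u A l e Q) {j : ℕ} (hj : j < q) :
    IsStage κ ν ((quadraticTransform ν)^[j] A) (Q 0 / Q 1 ^ j) (Q 1) ∧
      ∃ x y, IsCoordinateRing κ ((quadraticTransform ν)^[j] A) x y := by
  induction j with
  | zero => simpa using ⟨h.stage, h.coord⟩
  | succ j ih =>
    obtain ⟨ih, x, y, hxy⟩ := ih (by omega)
    rw [Function.iterate_succ_apply']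
    have hpos : 0 < ν (Q 0 / Q 1 ^ (j + 1)) :=
      h.stage.right_pos.trans_le (h.val_one_le hj)
    have := ih.quadraticTransform (h.ne_zero 1) (h.val_one_le (by omega)) (α := 0) (ρ := 1)
      (w := Q 0 / Q 1 ^ (j + 1)) (zero_mem _) (one_mem _) ν.map_one
      (by rw [pow_succ, div_div]; ring) hpos
    exact ⟨this.symm, hxy.exists_quadraticTransform ih this⟩

lemma le_iterate (ν : AddValuation K (WithTop ℝ)) (A : Subring K) (j : ℕ) :
    A ≤ (quadraticTransform ν)^[j] A := by
  induction j with
  | zero => exact le_rfl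
  | succ j ih =>
    rw [Function.iterate_succ_apply']
    exact ih.trans (le_quadraticTransform ν _)

/-- For `0 < j < q` both generators `Q_0 / Q_1 ^ j` and `Q_1` of the maximal ideal of
the `j`-th quadratic transform are primes dividing `u`. -/
lemma not_hasSingleComponent (h : IsFreeStage κ ν q u A l e Q) {j : ℕ} (hj0 : 0 < j) (hj : j < q) :
    ¬HasSingleComponent ((quadraticTransform ν)^[j] A) u := by
  obtain ⟨hs, x, y, hxy⟩ := h.isStage_iterate hj
  have hle := le_iterate ν A j
  have hA := fun i => hle (h.mem i)
  set B := (quadraticTransform ν)^[j] A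
  have h0 := h.ne_zero 0
  have h1 := h.ne_zero 1
  have hs0 : Q 0 / Q 1 ^ j ≠ 0 := div_ne_zero h0 (pow_ne_zero _ h1)
  have hst := hs.not_principal h1 h.two_le h.pos hA h.val
  have hts := hs.symm.not_principal hs0 h.two_le h.pos hA h.val
  have is := hs.irreducible_left hst
  have it := hs.symm.irreducible_left hts
  have ps := hxy.prime_of_irreducible is
  have pt := hxy.prime_of_irreducible it
  rintro ⟨hf, T, hT, n, hn, hass⟩
  obtain ⟨ε, hε, -, hu⟩ := h.unit_mul
  have e' : (⟨u, hf⟩ : B) = ⟨ε, hle hε⟩ * (⟨Q 0 / Q 1 ^ j, hs.left_mem⟩ *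
      ⟨Q 1, hs.right_mem⟩ ^ j) ^ e := by
    refine Subtype.ext ?_
    show u = ε * (Q 0 / Q 1 ^ j * Q 1 ^ j) ^ e
    rw [div_mul_cancel₀ _ (pow_ne_zero _ h1), hu]
  have hds : (⟨Q 0 / Q 1 ^ j, hs.left_mem⟩ : B) ∣ ⟨u, hf⟩ := by
    rw [e']
    exact ((dvd_mul_right _ _).trans (dvd_pow_self _ h.exp_pos.ne')).mul_left _
  have hdt : (⟨Q 1, hs.right_mem⟩ : B) ∣ ⟨u, hf⟩ := by
    rw [e']
    exact (((dvd_pow_self _ hj0.ne').mul_left _).trans (dvd_pow_self _ h.exp_pos.ne')).mul_left _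
  have as := is.associated_of_dvd hT (ps.dvd_of_dvd_pow (hds.trans hass.symm.dvd))
  have at' := it.associated_of_dvd hT (pt.dvd_of_dvd_pow (hdt.trans hass.symm.dvd))
  obtain ⟨c, hc⟩ := (at'.trans as.symm).dvd
  refine hst ⟨c, c.2, ?_⟩
  rw [mul_comm]
  exact congrArg Subtype.val hc

/-- The `q`-th quadratic transform is the next free ring; its sequence is obtained by dividing
`Q_{i+1}` by `Q_1 ^ q ^ i`. -/
theorem next (h : IsFreeStage κ ν q u A l e Q) {Q' : ℕ → K} (hQ0 : Q' 0 = Q 1)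
    (hQ : ∀ i, Q' (i + 1) = Q (i + 2) / Q 1 ^ q ^ (i + 1)) :
    IsFreeStage κ ν q u ((quadraticTransform ν)^[q] A) (l / q) (q * e) Q' := by
  have hq := h.two_le
  have hqr : (q : ℝ) ≠ 0 := by positivity
  obtain ⟨q', rfl⟩ : ∃ q', q = q' + 1 := ⟨q - 1, by omega⟩
  obtain ⟨hs, x, y, hxy⟩ := h.isStage_iterate (j := q') (by omega)
  have hle := le_iterate ν A q'
  obtain ⟨τ, hτ, hτ0, hrel⟩ := h.rel_one
  have hv := h.ne_zero 1
  have hτne := ne_zero_of_valuation_eq_zero hτ0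
  have hval : ∀ i, ν (Q' i) = ((l / (q' + 1 : ℕ) * keyValue (q' + 1) i : ℝ) : WithTop ℝ) := by
    intro i
    match i with
    | 0 => rw [hQ0, h.val_one, keyValue_zero, mul_one]
    | i + 1 =>
      rw [hQ, valuation_div_of_eq_coe (h.val (i + 2)) (valuation_pow_of_eq_coe h.val_one _)]
      congr 1
      have := mul_keyValue hq i
      have e2 : keyValue (q' + 1) (i + 2) = (((q' + 1 : ℕ) : ℝ) ^ (i + 1) +
          keyValue (q' + 1) (i + 1)) / (q' + 1 : ℕ) := by
        rw [← this]; field_simp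
      rw [e2]
      push_cast at hqr ⊢
      field_simp
      ring
  have hQ1 : Q' 1 = Q 2 / Q 1 ^ (q' + 1) := by rw [hQ]; simp
  have hw : Q' 1 = 1 + -τ * (Q 0 / Q 1 ^ q' / Q 1) := by
    have e2 : Q 2 = Q 1 ^ (q' + 1) - τ * Q 0 := by linear_combination -hrel
    rw [hQ1, e2, div_div, ← pow_succ, sub_div, div_self (pow_ne_zero _ hv)]
    ring
  have hwpos : 0 < ν (Q' 1) := by
    rw [hval]
    have := mul_pos (div_pos h.pos (by positivity : (0 : ℝ) < (q' + 1 : ℕ))) (keyValue_pos hq 1)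
    exact_mod_cast this
  have hB := hs.quadraticTransform hv (h.val_one_le (by omega)) (one_mem _)
    (neg_mem (hle hτ)) (by rwa [ν.map_neg]) hw hwpos
  rw [Function.iterate_succ_apply']
  set B := quadraticTransform ν ((quadraticTransform ν)^[q'] A)
  have hAB : A ≤ B := hle.trans (le_quadraticTransform ν _)
  -- the unit `ω = u_k / v_k ^ q` of the next ring
  obtain ⟨ω, hω⟩ : ∃ ω, ω = Q 0 / Q 1 ^ (q' + 1) := ⟨_, rfl⟩
  have hω0 : ν ω = 0 := by
    rw [hω, h.val_div, mul_div_cancel₀ _ hqr, sub_self]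
    rfl
  have hωB : ω ∈ B := by
    have e2 : ω = (1 - Q' 1) * τ⁻¹ := by
      rw [hω, hw]; field_simp; ring
    rw [e2]
    exact mul_mem (sub_mem (one_mem _) hB.right_mem) (hAB (h.stage.inv_mem τ hτ hτ0))
  have hu0 : Q 0 = ω * Q 1 ^ (q' + 1) := by rw [hω]; field_simp
  have hrel_one : ∃ τ ∈ B, ν τ = 0 ∧ Q' 1 ^ (q' + 1) = τ * Q' 0 + Q' 2 := by
    obtain ⟨σ, hσ, hσ0, e2⟩ := h.rel 0
    refine ⟨σ * ω ^ (q' + 1), mul_mem (hAB hσ) (pow_mem hωB _), ?_, ?_⟩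
    · rw [ν.map_mul, ν.map_pow, hσ0, hω0]; simp
    · have hpow : Q 1 ^ (q' + 1) ≠ 0 := pow_ne_zero _ hv
      rw [hQ1, hQ0, hQ 1, div_pow, ← pow_mul]
      have e3 : (q' + 1) ^ (1 + 1) = (q' + 1) * (q' + 1) := by ring
      simp only [zero_add, pow_one] at e2
      rw [e3, div_eq_iff (pow_ne_zero _ hv), add_mul, div_mul_cancel₀ _ (pow_ne_zero _ hv), e2,
        hu0, mul_pow, ← pow_mul]
      ring
  have hrel' : ∀ i, ∃ τ ∈ B, ν τ = 0 ∧ Q' (i + 2) ^ (q' + 1) =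
      τ * (Q' 0 ^ (q' + 1) ^ (i + 1) * Q' (i + 1)) + Q' (i + 3) := by
    intro i
    obtain ⟨σ, hσ, hσ0, e2⟩ := h.rel (i + 1)
    refine ⟨σ * ω ^ (q' + 1) ^ (i + 2), mul_mem (hAB hσ) (pow_mem hωB _), ?_, ?_⟩
    · rw [ν.map_mul, ν.map_pow, hσ0, hω0]; simp
    · rw [hQ (i + 1), hQ0, hQ i, hQ (i + 2), div_pow, ← pow_mul, ← pow_succ]
      rw [show i + 1 + 1 + 1 = i + 3 from rfl, div_eq_iff (pow_ne_zero _ hv), add_mul,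
        div_mul_cancel₀ _ (pow_ne_zero _ hv)]
      have e3 : Q (i + 1 + 2) ^ (q' + 1) = σ * (Q 0 ^ (q' + 1) ^ (i + 2) * Q (i + 2)) +
        Q (i + 2 + 2) := e2
      rw [show i + 1 + 2 = i + 1 + 2 from rfl, e3, hu0, mul_pow, ← pow_mul, ← pow_succ']
      field_simp
  have hmem : ∀ i, Q' i ∈ B ∧ Q' (i + 1) ∈ B ∧ Q' (i + 2) ∈ B := by
    intro i
    induction i with
    | zero =>
      have m0 : Q' 0 ∈ B := by rw [hQ0]; exact hB.left_mem
      obtain ⟨σ, hσ, -, e2⟩ := hrel_one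
      refine ⟨m0, hB.right_mem, ?_⟩
      rw [← sub_eq_iff_eq_add'.mpr e2]
      exact sub_mem (pow_mem hB.right_mem _) (mul_mem hσ m0)
    | succ i ih =>
      obtain ⟨σ, hσ, -, e2⟩ := hrel' i
      have m0 : Q' 0 ∈ B := by rw [hQ0]; exact hB.left_mem
      refine ⟨ih.2.1, ih.2.2, ?_⟩
      rw [show i + 1 + 2 = i + 3 from rfl, ← sub_eq_iff_eq_add'.mpr e2]
      exact sub_mem (pow_mem ih.2.2 _) (mul_mem hσ (mul_mem (pow_mem m0 _) ih.2.1))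
  refine
    { two_le := hq
      pos := div_pos h.pos (by positivity)
      exp_pos := Nat.mul_pos (by omega) h.exp_pos
      stage := by rw [hQ0]; exact hB
      coord := hxy.exists_quadraticTransform hs hB
      mem := fun i => (hmem i).1
      val := hval
      rel_one := hrel_one
      rel := hrel'
      unit_mul := ?_ }
  obtain ⟨ε, hε, hε0, rfl⟩ := h.unit_mul
  refine ⟨ε * ω ^ e, mul_mem (hAB hε) (pow_mem hωB _), ?_, ?_⟩
  · rw [ν.map_mul, ν.map_pow, hε0, hω0]; simp
  · rw [hQ0, hu0, mul_pow, ← pow_mul, mul_assoc]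

end IsFreeStage

end FreeStage

/-! ### The sequence of free rings -/

open MvPolynomial

section Main

variable {k K : Type*} [Field k] [Field K] [Algebra (MvPolynomial (Fin 2) k) K]
  [IsFractionRing (MvPolynomial (Fin 2) k) K]

lemma isCoordinateRing_originLocalRing :
    IsCoordinateRing ((algebraMap (MvPolynomial (Fin 2) k) K).comp C) (originLocalRing k K)
      (algebraMap (MvPolynomial (Fin 2) k) K (X 0))
      (algebraMap (MvPolynomial (Fin 2) k) K (X 1)) := by
  have hinj := IsFractionRing.injective (MvPolynomial (Fin 2) k) K
  refine ⟨?_, fun z => ?_⟩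
  · rwa [← ringHom_eq_coordHom]
  · rw [← ringHom_eq_coordHom]
    constructor
    · rintro ⟨f, g, hg, -, rfl⟩
      exact ⟨f, g, hg, rfl⟩
    · rintro ⟨f, g, hg, rfl⟩
      exact ⟨f, g, hg, (map_ne_zero_iff _ hinj).mpr (ne_zero_of_constantCoeff_ne_zero hg), rfl⟩

/-- The rings whose index is a multiple of `q = p ^ 2` are free, with the sequence `P_{n,i}`. -/
theorem isFreeStage {p : ℕ} (hp : p.Prime) {ν : AddValuation K (WithTop ℝ)}
    (h : IsDeterminedByP k p ν) {u v : K} (hu : u = algebraMap (MvPolynomial (Fin 2) k) K (X 0))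
    (hv : v = algebraMap (MvPolynomial (Fin 2) k) K (X 1)) (n : ℕ) :
    IsFreeStage ((algebraMap (MvPolynomial (Fin 2) k) K).comp C) ν (p ^ 2) u
      (transformSeq ν (originLocalRing k K) (p ^ 2 * n)) (1 / ((p ^ 2 : ℕ) : ℝ) ^ n)
      ((p ^ 2) ^ n) (PP p u v n) := by
  have hq : 2 ≤ p ^ 2 := by nlinarith [hp.two_le]
  induction n with
  | zero =>
    have hc := isCoordinateRing_originLocalRing (k := k) (K := K)
    have hval : ∀ i, ν (PP p u v 0 i) = (keyValue (p ^ 2) i : WithTop ℝ) := by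
      intro i
      rw [PP, P_eq_keyPoly, hu, hv, ← map_keyPoly]
      exact h.valuation_keyPoly hp i
    have hpos : ∀ i, 0 < ν (PP p u v 0 i) := by
      intro i
      rw [hval]
      exact_mod_cast keyValue_pos hq i
    refine
      { two_le := hq
        pos := by simp
        exp_pos := by simp
        stage := ?_
        coord := ⟨_, _, hc⟩
        mem := fun i => ?_
        val := by simpa using hval
        rel_one := ⟨1, one_mem _, ν.map_one, by simp [PP, P]⟩
        rel := fun i => ⟨1, one_mem _, ν.map_one, by simp [PP, P, pow_mul]⟩
        unit_mul := ⟨1, one_mem _, ν.map_one, by simp [PP, P]⟩ }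
    · have h0 := hpos 0
      have h1 := hpos 1
      simp only [PP, P, hu, hv] at h0 h1 ⊢
      exact hc.isStage h.trivial_on h0 h1
    · rw [PP, P_eq_keyPoly, hu, hv, ← map_keyPoly, ringHom_eq_coordHom (algebraMap _ K)]
      exact hc.map_mem _
  | succ n ih =>
    have e1 : transformSeq ν (originLocalRing k K) (p ^ 2 * (n + 1)) =
        (quadraticTransform ν)^[p ^ 2] (transformSeq ν (originLocalRing k K) (p ^ 2 * n)) := by
      rw [transformSeq, transformSeq, ← Function.iterate_add_apply]
      congr 2
      ring
    have e2 : 1 / ((p ^ 2 : ℕ) : ℝ) ^ (n + 1) = 1 / ((p ^ 2 : ℕ) : ℝ) ^ n / (p ^ 2 : ℕ) := by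
      rw [div_div, pow_succ]
    rw [e1, e2, pow_succ' (p ^ 2) n]
    refine ih.next (Q' := PP p u v (n + 1)) (by rw [PP]) fun i => ?_
    rw [PP, pow_mul]

lemma mem_freeIndices_iff {p : ℕ} (hp : p.Prime) {ν : AddValuation K (WithTop ℝ)}
    (h : IsDeterminedByP k p ν) {u v : K} (hu : u = algebraMap (MvPolynomial (Fin 2) k) K (X 0))
    (hv : v = algebraMap (MvPolynomial (Fin 2) k) K (X 1)) (n : ℕ) :
    n ∈ freeIndices ν (originLocalRing k K) u ↔ p ^ 2 ∣ n := by
  constructor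
  · intro hn
    by_contra hdvd
    have hq0 : 0 < p ^ 2 := by have := hp.pos; positivity
    refine (isFreeStage hp h hu hv (n / p ^ 2)).not_hasSingleComponent (j := n % p ^ 2)
      (Nat.pos_of_ne_zero fun h0 => hdvd (Nat.dvd_of_mod_eq_zero h0)) (Nat.mod_lt _ hq0) ?_
    rwa [transformSeq, ← Function.iterate_add_apply, Nat.mod_add_div]
  · rintro ⟨m, rfl⟩
    exact (isFreeStage hp h hu hv m).hasSingleComponent

lemma freeTransform_eq {p : ℕ} (hp : p.Prime) {ν : AddValuation K (WithTop ℝ)}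
    (h : IsDeterminedByP k p ν) {u v : K} (hu : u = algebraMap (MvPolynomial (Fin 2) k) K (X 0))
    (hv : v = algebraMap (MvPolynomial (Fin 2) k) K (X 1)) :
    (freeIndices ν (originLocalRing k K) u).Infinite ∧ ∀ n,
      freeTransform ν (originLocalRing k K) u n =
        transformSeq ν (originLocalRing k K) (p ^ 2 * n) := by
  have hq0 : 0 < p ^ 2 := by have := hp.pos; positivity
  have hmono : StrictMono fun n => p ^ 2 * n := fun _ _ hab => Nat.mul_lt_mul_of_pos_left hab hq0
  have hiff := mem_freeIndices_iff hp h hu hv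
  have hinf : (freeIndices ν (originLocalRing k K) u).Infinite :=
    (Set.infinite_range_of_injective hmono.injective).mono (by
      rintro _ ⟨m, rfl⟩
      exact (hiff _).mpr ⟨m, rfl⟩)
  refine ⟨hinf, fun n => ?_⟩
  have key := Nat.nth_comp_of_strictMono (p := fun m => m ∈ freeIndices ν (originLocalRing k K) u)
    (n := n) hmono
    (fun m hm => by
      obtain ⟨j, rfl⟩ := (hiff m).mp hm
      exact ⟨j, rfl⟩)
    (fun hfi => absurd hfi hinf)
  have htrue : (fun i => p ^ 2 * i ∈ freeIndices ν (originLocalRing k K) u) = fun _ => True := by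
    funext i
    exact eq_true ((hiff _).mpr ⟨i, rfl⟩)
  rw [htrue, Nat.nth_true] at key
  rw [freeTransform, ← key]

end Main

end QuadTransform

theorem theorem4p2 (p : ℕ) (hp : p.Prime) (k K : Type*) [Field k] [IsAlgClosed k] [CharP k p]
    [Field K] [Algebra (MvPolynomial (Fin 2) k) K] [IsFractionRing (MvPolynomial (Fin 2) k) K]
    (u v : K) (hu : u = algebraMap (MvPolynomial (Fin 2) k) K (MvPolynomial.X 0))
    (hv : v = algebraMap (MvPolynomial (Fin 2) k) K (MvPolynomial.X 1)) :
    (∃! ν : AddValuation K (WithTop ℝ), QuadTransform.IsDeterminedByP k p ν) ∧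
    ∀ ν : AddValuation K (WithTop ℝ), QuadTransform.IsDeterminedByP k p ν →
      (QuadTransform.freeIndices ν (QuadTransform.originLocalRing k K) u).Infinite ∧
      ∀ n : ℕ,
        QuadTransform.IsCenteredIn ν
          (QuadTransform.freeTransform ν (QuadTransform.originLocalRing k K) u n) ∧
        QuadTransform.IsGeneratingSequence ν
          (QuadTransform.freeTransform ν (QuadTransform.originLocalRing k K) u n)
          (QuadTransform.PP p u v n) ∧
        ν (QuadTransform.PP p u v n 0) = ((1 / (p : ℝ) ^ (2 * n) : ℝ) : WithTop ℝ) ∧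
        ν (QuadTransform.PP p u v n 1) = ((1 / (p : ℝ) ^ (2 * n + 2) : ℝ) : WithTop ℝ) ∧
        ∀ i : ℕ, 1 ≤ i →
          ν (QuadTransform.PP p u v n i) =
            ((∑ j ∈ Finset.range i, (p : ℝ) ^ (4 * (j : ℤ) - 2 * (i : ℤ) - 2 * (n : ℤ)) : ℝ) :
              WithTop ℝ) := by
  have : Fact p.Prime := ⟨hp⟩
  have hp0 : (p : ℝ) ≠ 0 := by exact_mod_cast hp.ne_zero
  refine ⟨?_, fun ν hν => ?_⟩
  · obtain ⟨ν, hν⟩ := QuadTransform.exists_isDeterminedByP k K (p := p)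
    exact ⟨ν, hν, fun ν' hν' => hν'.unique hp hν⟩
  obtain ⟨hinf, heq⟩ := QuadTransform.freeTransform_eq hp hν hu hv
  refine ⟨hinf, fun n => ?_⟩
  have hn := QuadTransform.isFreeStage hp hν hu hv n
  rw [heq n]
  refine ⟨hn.stage.isCenteredIn, hn.isGeneratingSequence, ?_, ?_, fun i hi => ?_⟩
  · rw [hn.val, QuadTransform.keyValue_zero, mul_one]
    push_cast
    rw [← pow_mul]
  · rw [hn.val, QuadTransform.keyValue_one]
    congr 1
    push_cast
    rw [← pow_mul, pow_add, div_mul_div_comm, mul_one]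
  · rw [hn.val]
    congr 1
    obtain ⟨i, rfl⟩ := Nat.exists_eq_add_of_le' hi
    rw [QuadTransform.keyValue, QuadTransform.keyNumer_eq]
    push_cast
    rw [Finset.sum_div, Finset.mul_sum]
    refine Finset.sum_congr rfl fun j _ => ?_
    rw [zpow_sub₀ hp0, zpow_sub₀ hp0, ← pow_mul, ← pow_mul, ← pow_mul]
    have e1 : (p : ℝ) ^ (4 * (j : ℤ)) = (p : ℝ) ^ (2 * (2 * j)) := by
      rw [← zpow_natCast]; congr 1; push_cast; ring
    have e2 : (p : ℝ) ^ (2 * ((i : ℤ) + 1)) = (p : ℝ) ^ (2 * (i + 1)) := by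
      rw [← zpow_natCast]; congr 1
    have e3 : (p : ℝ) ^ (2 * (n : ℤ)) = (p : ℝ) ^ (2 * n) := by
      rw [← zpow_natCast]; congr 1
    rw [e1, e2, e3]
    field_simp
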